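/- Let $\Gamma$ be a subgroup of $\mathrm{SL}(2,\mathbb{C})$ and let $R$ be a commutative $\mathbb{C}$-algebra of differentiable (holomorphic) functions of one complex variable $z$ which is a domain, such that: (i) $\Gamma$ acts on the right on $R$ by $(f\cdot\gamma)(z)=f\!\left(\frac{az+b}{cz+d}\right)$ for $\gamma=\begin{pmatrix}a&b\\c&d\end{pmatrix}\in\Gamma$; (ii) the function $z\mapsto cz+d$ is an invertible element of $R$ for every $\gamma\in\Gamma$; (iii) $R$ is stable under $\partial_z$. (Functions are defined on members of a fixed filter on $\mathbb{C}$ that has a basis of open sets and is preserved by $\Gamma$, i.e. $z\mapsto\frac{az+b}{cz+d}$ tends to this filter along itself for every $\gamma\in\Gamma$; two functions are identified when they agree on a member of it. This covers algebras of holomorphic or meromorphic functions on a $\Gamma$-stable open set as well as $\mathbb{C}(z)$.) Let $B=R(\!(x;-\partial_z)\!)$ be the ring of formal Laurent series $\sum_{i\ge m}f_ix^i$ ($m\in\mathbb{Z}$, $f_i\in R$) with the product determined by $$x^{i}f=\sum_{k\ge0}\Big(\prod_{j=1}^{k}\frac{i+j-1}{j}\Big)(-\partial_z)^k(f)\,x^{i+k}\qquad(i\in\mathbb{Z},\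 f\in R),$$ and let $C=R(\!(y;-\tfrac12\partial_z)\!)_2$ be the ring of formal Laurent series $\sum_{i\ge m}f_iy^i$ with the product determined by $$y^{i}f=\sum_{k\ge0}\Big(\prod_{j=1}^{k}\frac{i+2(j-1)}{j}\Big)\big(-\tfrac12\partial_z\big)^k(f)\,y^{i+2k}\qquad(i\in\mathbb{Z},\ f\in R);$$ $B$ is contained in $C$ through $x=y^2$. The action of $\Gamma$ on $R$ extends to a right action by ring automorphisms on $B$ such that $x^{-1}\cdot\gamma=(cz+d)^2x^{-1}$ for all $\gamma\in\Gamma$, and to a right action by ring automorphisms on $C$ such that, for all $\gamma\in\Gamma$, $y\cdot\gamma$ is the square root of $x(cz+d)^{-2}$ in $C$ whose term of minimal valuation is $(cz+d)^{-1}y$; these two actions can be chosen so that the action on $C$ restricts to the action on $B$. Moreover, for every such extension to $B$ and every $\gamma=\begin{pmatrix}a&b\\c&d\end{pmatrix}\in\Gamma$, $$x\cdot\gamma=\sum_{n\ge0}(n+1)!\,(cz+d)^{-2}\Big(\frac{c}{cz+d}\Big)^{n}x^{n+1},$$ and for every such extension to $C$ and every $\gamma\in\Gamma$, $$y\cdot\gamma=\sum_{u\ge0}\frac{(2u+1)!\,(2u)!}{16^{u}\,(u!)^3}\,(cz+d)^{-1}\Big(\frac{c}{cz+d}\Big)^{u}y^{2u+1}.$$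 -/

import Mathlib

open Filter Topology

/-- The coefficient `c_k(s) = ∏_{j=1}^{k} (s + N (j - 1)) / j` of the commutation law
`X ^ i f = ∑_k c_k(i) δ^k(f) X ^ (i + N k)`. -/
noncomputable def twistCoeff (N : ℕ) (s : ℂ) (k : ℕ) : ℂ :=
  ∏ j ∈ Finset.range k, (s + N * j) / (j + 1)

theorem twistCoeff_succ (N : ℕ) (s : ℂ) (k : ℕ) :
    ((k : ℂ) + 1) * twistCoeff N s (k + 1) = (s + N * k) * twistCoeff N s k := by
  have : (k : ℂ) + 1 ≠ 0 := Nat.cast_add_one_ne_zero k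
  rw [twistCoeff, Finset.prod_range_succ, ← twistCoeff]
  field_simp

theorem twistCoeff_zero_left (N : ℕ) (k : ℕ) (hk : k ≠ 0) : twistCoeff N 0 k = 0 := by
  refine Finset.prod_eq_zero (i := 0) (by simpa using Nat.pos_of_ne_zero hk) (by simp)

theorem twistCoeff_add (N : ℕ) (s t : ℂ) (n : ℕ) :
    twistCoeff N (s + t) n = ∑ p ∈ Finset.HasAntidiagonal.antidiagonal n, twistCoeff N s p.1 * twistCoeff N t p.2 := by
  induction n with
  | zero => simp [twistCoeff]
  | succ n ih =>
    have h0 : (n : ℂ) + 1 ≠ 0 := Nat.cast_add_one_ne_zero n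
    apply mul_left_cancel₀ h0
    rw [twistCoeff_succ, ih]
    have e : ((n : ℂ) + 1) * ∑ p ∈ Finset.HasAntidiagonal.antidiagonal (n + 1),
          twistCoeff N s p.1 * twistCoeff N t p.2 =
        ∑ p ∈ Finset.HasAntidiagonal.antidiagonal (n + 1), (p.1 : ℂ) * twistCoeff N s p.1 * twistCoeff N t p.2 +
        ∑ p ∈ Finset.HasAntidiagonal.antidiagonal (n + 1),
          twistCoeff N s p.1 * ((p.2 : ℂ) * twistCoeff N t p.2) := by
      rw [Finset.mul_sum, ← Finset.sum_add_distrib]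
      refine Finset.sum_congr rfl fun p hp => ?_
      have : ((p.1 : ℂ) + p.2) = n + 1 := by exact_mod_cast Finset.HasAntidiagonal.mem_antidiagonal.1 hp
      rw [← this]; ring
    rw [e, Finset.Nat.sum_antidiagonal_succ, Finset.Nat.sum_antidiagonal_succ']
    simp only [Nat.cast_zero, zero_mul, mul_zero, zero_add, Nat.cast_add, Nat.cast_one,
      twistCoeff_succ]
    rw [Finset.mul_sum, ← Finset.sum_add_distrib]
    refine Finset.sum_congr rfl fun p hp => ?_
    have : ((p.1 : ℂ) + p.2) = n := by exact_mod_cast Finset.HasAntidiagonal.mem_antidiagonal.1 hp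
    rw [← this]; ring

theorem twistCoeff_mul_choose (N : ℕ) (s : ℂ) (a t : ℕ) :
    twistCoeff N s (a + t) * ((a + t).choose a : ℂ) =
      twistCoeff N s a * twistCoeff N (s + N * a) t := by
  induction t with
  | zero => simp [twistCoeff]
  | succ t ih =>
    have h0 : (t : ℂ) + 1 ≠ 0 := Nat.cast_add_one_ne_zero t
    apply mul_left_cancel₀ h0
    have h1 := twistCoeff_succ N s (a + t)
    have h2 := twistCoeff_succ N (s + N * a) t
    have h3 : ((a + t + 1).choose a : ℂ) * (t + 1) = (a + t + 1) * (a + t).choose a := by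
      have := Nat.add_one_mul_choose_eq (a + t) t
      have e1 : (a + t).choose t = (a + t).choose a := by
        rw [Nat.choose_symm_add]
      have e2 : (a + t + 1).choose (t + 1) = (a + t + 1).choose a := by
        rw [add_assoc, Nat.choose_symm_add]
      simp only [e1, e2] at this
      exact_mod_cast this.symm
    push_cast at h1
    calc ((t : ℂ) + 1) * (twistCoeff N s (a + t + 1) * ((a + t + 1).choose a : ℂ))
        = ((a + t + 1 : ℂ) * twistCoeff N s (a + t + 1)) * (a + t).choose a := by
          rw [mul_comm ((t : ℂ) + 1), mul_assoc, h3]; ring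
      _ = (s + N * (a + t)) * (twistCoeff N s (a + t) * (a + t).choose a) := by rw [h1]; ring
      _ = twistCoeff N s a * (((t : ℂ) + 1) * twistCoeff N (s + N * a) (t + 1)) := by
          rw [ih, h2]; ring
      _ = _ := by ring

/-- Formal skew Laurent series `∑_{i ≥ m} f_i X ^ i` with coefficients on the left in `R`,
for the commutation law
`X ^ i f = ∑_{k ≥ 0} (∏_{j=1}^{k} (i + N (j - 1)) / j) δ^k(f) X ^ (i + N k)`.
For `N = 1` this is the ring of formal pseudodifferential operators `R((x; δ))`, with
`x f = ∑_k δ^k(f) x ^ (k + 1)`; for `N = 2` it is the ring of quadratic formal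
pseudodifferential operators `R((y; δ))₂`, with
`y f = ∑_k (2k)! / (2 ^ k (k!) ^ 2) δ^k(f) y ^ (2 k + 1)`. -/
@[ext]
structure SkewLaurent (N : ℕ) {R : Type*} [CommRing R] [Algebra ℂ R] (δ : Derivation ℂ R R) where
  /-- the coefficient of `X ^ i` -/
  coeff : ℤ → R
  bddBelow' : ∃ m : ℤ, ∀ i < m, coeff i = 0

namespace SkewLaurent

variable {N : ℕ} {R : Type*} [CommRing R] [Algebra ℂ R] {δ : Derivation ℂ R R}

/-- All coefficients of index `< m` vanish, i.e. the valuation is at least `m`. -/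
def ValGE (q : SkewLaurent N δ) (m : ℤ) : Prop := ∀ i < m, q.coeff i = 0

theorem exists_valGE (q : SkewLaurent N δ) : ∃ m, q.ValGE m := q.bddBelow'

theorem ValGE.mono {q : SkewLaurent N δ} {m n : ℤ} (h : q.ValGE m) (hn : n ≤ m) : q.ValGE n :=
  fun i hi => h i (by omega)

instance : Zero (SkewLaurent N δ) := ⟨⟨fun _ => 0, 0, fun _ _ => rfl⟩⟩

instance : Add (SkewLaurent N δ) :=
  ⟨fun q p => ⟨fun i => q.coeff i + p.coeff i, by
    obtain ⟨a, ha⟩ := q.bddBelow'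
    obtain ⟨b, hb⟩ := p.bddBelow'
    exact ⟨min a b, fun i hi => by rw [ha i (by omega), hb i (by omega), add_zero]⟩⟩⟩

instance : Neg (SkewLaurent N δ) :=
  ⟨fun q => ⟨fun i => -q.coeff i, by
    obtain ⟨a, ha⟩ := q.bddBelow'
    exact ⟨a, fun i hi => by rw [ha i hi, neg_zero]⟩⟩⟩

@[simp] theorem coeff_zero (i : ℤ) : (0 : SkewLaurent N δ).coeff i = 0 := rfl
@[simp] theorem coeff_add (q p : SkewLaurent N δ) (i : ℤ) :
    (q + p).coeff i = q.coeff i + p.coeff i := rfl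
@[simp] theorem coeff_neg (q : SkewLaurent N δ) (i : ℤ) : (-q).coeff i = -q.coeff i := rfl

instance : AddCommGroup (SkewLaurent N δ) where
  add_assoc a b c := by ext i; exact add_assoc _ _ _
  zero_add a := by ext i; exact zero_add _
  add_zero a := by ext i; exact add_zero _
  nsmul := nsmulRec
  zsmul := zsmulRec
  neg_add_cancel a := by ext i; exact neg_add_cancel _
  add_comm a b := by ext i; exact add_comm _ _

@[simp] theorem coeff_sub (q p : SkewLaurent N δ) (i : ℤ) :
    (q - p).coeff i = q.coeff i - p.coeff i := by
  rw [sub_eq_add_neg, coeff_add, coeff_neg, sub_eq_add_neg]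

theorem coeff_sum {ι : Type*} (s : Finset ι) (q : ι → SkewLaurent N δ) (i : ℤ) :
    (∑ j ∈ s, q j).coeff i = ∑ j ∈ s, (q j).coeff i := by
  classical
  induction s using Finset.induction_on with
  | empty => simp
  | insert a s ha ih => rw [Finset.sum_insert ha, Finset.sum_insert ha, coeff_add, ih]

/-- The term, in the coefficient of `X ^ m` in the product `q p`, which comes from
`q_i X ^ i · p_j X ^ j` and the summand `δ^k(p_j) X ^ (i + N k)` of `X ^ i p_j`;
so `j = m - i - N k`. -/
noncomputable def mulTerm (q p : SkewLaurent N δ) (m : ℤ) (t : ℤ × ℕ) : R :=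
  twistCoeff N (t.1 : ℂ) t.2 • (q.coeff t.1 * (δ^[t.2]) (p.coeff (m - t.1 - N * t.2)))

theorem iter_zero (k : ℕ) : (δ^[k]) (0 : R) = 0 := iterate_map_zero δ k

theorem mulTerm_eq_zero {q p : SkewLaurent N δ} {a b : ℤ} (hq : q.ValGE a) (hp : p.ValGE b)
    (m : ℤ) (t : ℤ × ℕ) (h : t.1 < a ∨ m < t.1 + N * t.2 + b) : mulTerm q p m t = 0 := by
  rcases h with h | h
  · rw [mulTerm, hq _ h, zero_mul, smul_zero]
  · rw [mulTerm, hp _ (by omega), iter_zero, mul_zero, smul_zero]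

/-- The product
`(∑ f_i X ^ i) (∑ g_j X ^ j) = ∑_{i,j,k} (∏_{l=1}^{k} (i + N (l - 1)) / l) f_i δ^k(g_j) X ^ (i + j + N k)`;
only finitely many terms contribute to a given power of `X` when `N ≠ 0`. -/
noncomputable instance : Mul (SkewLaurent N δ) :=
  ⟨fun q p => ⟨fun m => ∑ᶠ t : ℤ × ℕ, mulTerm q p m t, by
    obtain ⟨a, ha⟩ := q.exists_valGE
    obtain ⟨b, hb⟩ := p.exists_valGE
    refine ⟨a + b, fun m hm => finsum_eq_zero_of_forall_eq_zero fun t => ?_⟩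
    refine mulTerm_eq_zero ha hb m t ?_
    by_contra! h
    have : (0 : ℤ) ≤ N * t.2 := by positivity
    omega⟩⟩

theorem coeff_mul (q p : SkewLaurent N δ) (m : ℤ) :
    (q * p).coeff m = ∑ᶠ t : ℤ × ℕ, mulTerm q p m t := rfl

/-- The monomial `f X ^ i`. -/
def single (i : ℤ) (f : R) : SkewLaurent N δ :=
  ⟨Pi.single i f, i, fun j hj => by rw [Pi.single_eq_of_ne (by omega)]⟩

theorem coeff_single (i j : ℤ) (f : R) :
    (single i f : SkewLaurent N δ).coeff j = if j = i then f else 0 := by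
  simp [single, Pi.single_apply]

theorem valGE_single (i : ℤ) (f : R) : (single i f : SkewLaurent N δ).ValGE i :=
  fun j hj => by rw [coeff_single, if_neg (by omega)]

noncomputable instance : One (SkewLaurent N δ) := ⟨single 0 1⟩

theorem one_def : (1 : SkewLaurent N δ) = single 0 1 := rfl

theorem ValGE.mul {q p : SkewLaurent N δ} {a b : ℤ} (hq : q.ValGE a) (hp : p.ValGE b) :
    (q * p).ValGE (a + b) := fun m hm => by
  refine finsum_eq_zero_of_forall_eq_zero fun t => mulTerm_eq_zero hq hp m t ?_
  by_contra! h
  have : (0 : ℤ) ≤ N * t.2 := by positivity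
  omega

section ring

variable [NeZero N]

theorem coeff_mul_eq_sum {q p : SkewLaurent N δ} {a b : ℤ} (hq : q.ValGE a) (hp : p.ValGE b)
    (m B : ℤ) (K : ℕ) (hB : m - b < B) (hK : m - b - a < K) :
    (q * p).coeff m = ∑ i ∈ Finset.Ico a B, ∑ k ∈ Finset.range K, mulTerm q p m (i, k) := by
  rw [coeff_mul, ← Finset.sum_product']
  refine finsum_eq_sum_of_support_subset _ fun t ht => ?_
  rw [Function.mem_support] at ht
  have h1 := mt (mulTerm_eq_zero hq hp m t) ht
  push Not at h1
  have hN : (1 : ℤ) ≤ N := by exact_mod_cast Nat.one_le_iff_ne_zero.2 (NeZero.ne N)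
  have h2 : (t.2 : ℤ) ≤ N * t.2 := le_mul_of_one_le_left (by positivity) hN
  simp only [Finset.coe_product, Finset.coe_Ico, Finset.coe_range, Set.mem_prod, Set.mem_Ico,
    Set.mem_Iio]
  refine ⟨⟨h1.1, by omega⟩, by omega⟩

theorem left_distrib' (q p r : SkewLaurent N δ) : q * (p + r) = q * p + q * r := by
  ext m
  obtain ⟨a, ha⟩ := q.exists_valGE
  obtain ⟨b, hb⟩ := p.exists_valGE
  obtain ⟨c, hc⟩ := r.exists_valGE
  have hb' := hb.mono (min_le_left b c)
  have hc' := hc.mono (min_le_right b c)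
  have hs : (p + r).ValGE (min b c) := fun i hi => by rw [coeff_add, hb' i hi, hc' i hi, add_zero]
  set d := min b c
  have h1 : m - d < m - d + 1 := by omega
  have h2 : m - d - a < ((m - d - a).toNat + 1 : ℕ) := by omega
  rw [coeff_add, coeff_mul_eq_sum ha hs m _ _ h1 h2, coeff_mul_eq_sum ha hb' m _ _ h1 h2,
    coeff_mul_eq_sum ha hc' m _ _ h1 h2]
  simp only [← Finset.sum_add_distrib, mulTerm, coeff_add, iterate_map_add, mul_add, smul_add]

theorem right_distrib' (p r q : SkewLaurent N δ) : (p + r) * q = p * q + r * q := by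
  ext m
  obtain ⟨a, ha⟩ := q.exists_valGE
  obtain ⟨b, hb⟩ := p.exists_valGE
  obtain ⟨c, hc⟩ := r.exists_valGE
  have hb' := hb.mono (min_le_left b c)
  have hc' := hc.mono (min_le_right b c)
  have hs : (p + r).ValGE (min b c) := fun i hi => by rw [coeff_add, hb' i hi, hc' i hi, add_zero]
  set d := min b c
  have h1 : m - a < m - a + 1 := by omega
  have h2 : m - a - d < ((m - a - d).toNat + 1 : ℕ) := by omega
  rw [coeff_add, coeff_mul_eq_sum hs ha m _ _ h1 h2, coeff_mul_eq_sum hb' ha m _ _ h1 h2,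
    coeff_mul_eq_sum hc' ha m _ _ h1 h2]
  simp only [← Finset.sum_add_distrib, mulTerm, coeff_add, add_mul, smul_add]

noncomputable instance : NonUnitalNonAssocRing (SkewLaurent N δ) where
  left_distrib := left_distrib'
  right_distrib := right_distrib'
  zero_mul p := by ext m; exact finsum_eq_zero_of_forall_eq_zero fun t => by simp [mulTerm]
  mul_zero p := by
    ext m; exact finsum_eq_zero_of_forall_eq_zero fun t => by simp [mulTerm]

theorem coeff_single_mul (i : ℤ) (f : R) {p : SkewLaurent N δ} {b : ℤ} (hp : p.ValGE b)
    (m : ℤ) (K : ℕ) (hK : m - b - i < K) :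
    (single i f * p).coeff m =
      ∑ k ∈ Finset.range K, twistCoeff N (i : ℂ) k • (f * (δ^[k]) (p.coeff (m - i - N * k))) := by
  rw [coeff_mul_eq_sum (valGE_single i f) hp m (max (m - b + 1) (i + 1)) K (by omega) hK,
    Finset.sum_eq_single i]
  · simp [mulTerm, coeff_single]
  · intro j _ hj
    simp [mulTerm, coeff_single, hj]
  · intro h
    exact absurd (Finset.mem_Ico.2 ⟨le_rfl, by omega⟩) h

theorem coeff_mul_single {q : SkewLaurent N δ} {a : ℤ} (hq : q.ValGE a) (l : ℤ) (h : R)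
    (m : ℤ) (K : ℕ) (hK : m - l - a < K) :
    (q * single l h).coeff m = ∑ k ∈ Finset.range K,
      twistCoeff N ((m - l - N * k : ℤ) : ℂ) k • (q.coeff (m - l - N * k) * (δ^[k]) h) := by
  rw [coeff_mul_eq_sum hq (valGE_single l h) m (m - l + 1) K (by omega) hK, Finset.sum_comm]
  refine Finset.sum_congr rfl fun k _ => ?_
  have hk : (0 : ℤ) ≤ N * k := by positivity
  by_cases hc : a ≤ m - l - N * k
  · rw [Finset.sum_eq_single (m - l - N * k)]
    · simp only [mulTerm, coeff_single]
      rw [if_pos (by ring)]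
    · intro j _ hj
      simp only [mulTerm, coeff_single]
      rw [if_neg (by omega), iter_zero, mul_zero, smul_zero]
    · intro h
      exact absurd (Finset.mem_Ico.2 ⟨hc, by omega⟩) h
  · rw [hq _ (by omega), zero_mul, smul_zero]
    refine Finset.sum_eq_zero fun j hj => ?_
    rw [Finset.mem_Ico] at hj
    simp only [mulTerm, coeff_single]
    rw [if_neg (by omega), iter_zero, mul_zero, smul_zero]

theorem one_mul' (p : SkewLaurent N δ) : 1 * p = p := by
  ext m
  obtain ⟨b, hb⟩ := p.exists_valGE
  rw [one_def, coeff_single_mul 0 1 hb m ((m - b).toNat + 1) (by omega), Finset.sum_eq_single 0]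
  · simp [twistCoeff]
  · intro k _ hk
    rw [Int.cast_zero, twistCoeff_zero_left N k hk, zero_smul]
  · simp

theorem mul_one' (p : SkewLaurent N δ) : p * 1 = p := by
  ext m
  obtain ⟨b, hb⟩ := p.exists_valGE
  rw [one_def, coeff_mul_single hb 0 1 m ((m - b).toNat + 1) (by omega), Finset.sum_eq_single 0]
  · simp [twistCoeff]
  · intro k _ hk
    obtain ⟨k, rfl⟩ := Nat.exists_eq_succ_of_ne_zero hk
    rw [Function.iterate_succ_apply, Derivation.map_one_eq_zero, iter_zero, mul_zero, smul_zero]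
  · simp

theorem iter_smul (k : ℕ) (c : ℂ) (f : R) : (δ^[k]) (c • f) = c • (δ^[k]) f := by
  induction k generalizing f with
  | zero => rfl
  | succ k ih => rw [Function.iterate_succ_apply, δ.map_smul, ih, Function.iterate_succ_apply]

theorem iter_leibniz (n : ℕ) (f g : R) : (δ^[n]) (f * g) =
    ∑ p ∈ Finset.HasAntidiagonal.antidiagonal n, (n.choose p.1 : ℂ) • ((δ^[p.1]) f * (δ^[p.2]) g) := by
  induction n with
  | zero => simp
  | succ n ih =>
    have key := Finset.sum_antidiagonal_choose_succ_nsmul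
      (fun i j => (δ^[i]) f * (δ^[j]) g) n
    simp only [Nat.cast_smul_eq_nsmul] at ih ⊢
    rw [Function.iterate_succ_apply', ih, map_sum, key, ← Finset.sum_add_distrib]
    refine Finset.sum_congr rfl fun p hp => ?_
    have hc : n.choose p.2 = n.choose p.1 :=
      Nat.choose_symm_of_eq_add (Finset.HasAntidiagonal.mem_antidiagonal.1 hp).symm |>.symm ▸ rfl
    rw [map_nsmul, Derivation.leibniz, Function.iterate_succ_apply', Function.iterate_succ_apply',
      smul_eq_mul, smul_eq_mul, smul_add, hc, mul_comm ((δ^[p.2]) g)]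


theorem sum_range_range_ite {M : Type*} [AddCommMonoid M] (K n : ℕ) (hn : n < K) (F : ℕ → ℕ → M) :
    ∑ a ∈ Finset.range K, ∑ b ∈ Finset.range K, (if a + b = n then F a b else 0) =
      ∑ p ∈ Finset.HasAntidiagonal.antidiagonal n, F p.1 p.2 := by
  rw [← Finset.sum_product', ← Finset.sum_filter]
  refine Finset.sum_congr ?_ fun _ _ => rfl
  ext ⟨a, b⟩
  simp only [Finset.mem_filter, Finset.mem_product, Finset.mem_range,
    Finset.HasAntidiagonal.mem_antidiagonal]
  omega

theorem single_mul_assoc (i j l : ℤ) (f g h : R) :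
    (single i f * single j g) * single l h =
      (single i f * (single j g * single l h) : SkewLaurent N δ) := by
  have hN : (N : ℤ) ≠ 0 := by exact_mod_cast NeZero.ne N
  ext m
  set K : ℕ := (m - i - j - l).toNat + 1 with hKdef
  have pos : ∀ b : ℕ, (0 : ℤ) ≤ N * b := fun b => by positivity
  have hL : ((single i f * single j g) * single l h : SkewLaurent N δ).coeff m =
      ∑ a ∈ Finset.range K, ∑ b ∈ Finset.range K,
        if (N : ℤ) * (a + b : ℕ) = m - i - j - l then
          (twistCoeff N i a * twistCoeff N (i + j + N * a) b) • (f * ((δ^[a]) g * (δ^[b]) h))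
        else 0 := by
    rw [coeff_mul_single ((valGE_single i f).mul (valGE_single j g)) l h m K (by omega),
      Finset.sum_comm]
    refine Finset.sum_congr rfl fun b _ => ?_
    rw [coeff_single_mul i f (valGE_single j g) _ K (by have := pos b; omega),
      Finset.sum_mul, Finset.smul_sum]
    refine Finset.sum_congr rfl fun a _ => ?_
    rw [coeff_single]
    by_cases hc : (N : ℤ) * (a + b : ℕ) = m - i - j - l
    · have e : m - l - N * b = i + j + N * a := by push_cast at hc; linarith
      rw [if_pos hc, if_pos (by rw [e]; ring), e, smul_mul_assoc, smul_smul, mul_comm, mul_assoc]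
      push_cast
      rfl
    · rw [if_neg hc, if_neg (fun h' => hc (by push_cast; linarith)), iter_zero, mul_zero, smul_zero,
        zero_mul, smul_zero]
  have hR : (single i f * (single j g * single l h) : SkewLaurent N δ).coeff m =
      ∑ a ∈ Finset.range K, ∑ b ∈ Finset.range K,
        if (N : ℤ) * (a + b : ℕ) = m - i - j - l then
          (twistCoeff N i a * twistCoeff N j b) • (f * (δ^[a]) (g * (δ^[b]) h))
        else 0 := by
    rw [coeff_single_mul i f ((valGE_single j g).mul (valGE_single l h)) m K (by omega)]
    refine Finset.sum_congr rfl fun a _ => ?_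
    rw [coeff_single_mul j g (valGE_single l h) _ K (by have := pos a; omega)]
    have := fun (F : ℕ → R) (s : Finset ℕ) =>
      map_sum (AddMonoidHom.mk' (δ^[a]) (iterate_map_add δ a)) F s
    simp only [AddMonoidHom.mk'_apply] at this
    rw [this, Finset.mul_sum, Finset.smul_sum]
    refine Finset.sum_congr rfl fun b _ => ?_
    rw [coeff_single, iter_smul]
    by_cases hc : (N : ℤ) * (a + b : ℕ) = m - i - j - l
    · rw [if_pos hc, if_pos (by push_cast at hc; linarith), mul_smul_comm, smul_smul]
    · rw [if_neg hc, if_neg (fun h' => hc (by push_cast; linarith)), iter_zero, mul_zero, iter_zero,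
        smul_zero, mul_zero, smul_zero]
  rw [hL, hR]
  by_cases hn : ∃ n : ℕ, (N : ℤ) * n = m - i - j - l
  · obtain ⟨n, hn⟩ := hn
    have hnK : n < K := by
      have : (n : ℤ) ≤ N * n := le_mul_of_one_le_left (by positivity) (by
        have := Nat.pos_of_ne_zero (NeZero.ne N); omega)
      omega
    have hiff : ∀ a b : ℕ, ((N : ℤ) * (a + b : ℕ) = m - i - j - l) ↔ a + b = n := fun a b => by
      rw [← hn, mul_right_inj' hN, Nat.cast_inj]
    simp only [hiff]
    rw [sum_range_range_ite K n hnK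
        (fun a b => (twistCoeff N i a * twistCoeff N (i + j + N * a) b) •
          (f * ((δ^[a]) g * (δ^[b]) h))),
      sum_range_range_ite K n hnK
        (fun a b => (twistCoeff N i a * twistCoeff N j b) • (f * (δ^[a]) (g * (δ^[b]) h)))]
    have e1 : ∀ a b : ℕ, (twistCoeff N i a * twistCoeff N (i + j + N * a) b) •
          (f * ((δ^[a]) g * (δ^[b]) h)) =
        ∑ p ∈ Finset.HasAntidiagonal.antidiagonal b,
          (twistCoeff N i a * (twistCoeff N (i + N * a) p.1 * twistCoeff N j p.2)) •
            (f * ((δ^[a]) g * (δ^[p.1 + p.2]) h)) := fun a b => by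
      rw [show (i : ℂ) + j + N * a = (i + N * a) + j by ring, twistCoeff_add, Finset.mul_sum,
        Finset.sum_smul]
      refine Finset.sum_congr rfl fun p hp => ?_
      rw [Finset.HasAntidiagonal.mem_antidiagonal.1 hp]
    have e2 : ∀ a b : ℕ, (twistCoeff N i a * twistCoeff N j b) • (f * (δ^[a]) (g * (δ^[b]) h)) =
        ∑ p ∈ Finset.HasAntidiagonal.antidiagonal a,
          (twistCoeff N i p.1 * (twistCoeff N (i + N * p.1) p.2 * twistCoeff N j b)) •
            (f * ((δ^[p.1]) g * (δ^[p.2 + b]) h)) := fun a b => by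
      rw [iter_leibniz, Finset.mul_sum, Finset.smul_sum]
      refine Finset.sum_congr rfl fun p hp => ?_
      rw [← Function.iterate_add_apply, mul_smul_comm, smul_smul]
      have := twistCoeff_mul_choose N i p.1 p.2
      rw [Finset.HasAntidiagonal.mem_antidiagonal.1 hp] at this
      congr 1
      rw [← mul_assoc, ← this]; ring
    simp only [e1, e2]
    rw [Finset.sum_sigma', Finset.sum_sigma']
    refine Finset.sum_nbij' (fun x => ⟨(x.1.1 + x.2.1, x.2.2), (x.1.1, x.2.1)⟩)
      (fun x => ⟨(x.2.1, x.2.2 + x.1.2), (x.2.2, x.1.2)⟩) ?_ ?_ ?_ ?_ ?_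
    · rintro ⟨⟨a, b⟩, ⟨c, d⟩⟩
      simp only [Finset.mem_sigma, Finset.HasAntidiagonal.mem_antidiagonal]
      rintro ⟨h1, h2⟩
      exact ⟨by omega, trivial⟩
    · rintro ⟨⟨a, b⟩, ⟨c, d⟩⟩
      simp only [Finset.mem_sigma, Finset.HasAntidiagonal.mem_antidiagonal]
      rintro ⟨h1, h2⟩
      exact ⟨by omega, trivial⟩
    · rintro ⟨⟨a, b⟩, ⟨c, d⟩⟩
      simp only [Finset.mem_sigma, Finset.HasAntidiagonal.mem_antidiagonal]
      rintro ⟨-, rfl⟩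
      rfl
    · rintro ⟨⟨a, b⟩, ⟨c, d⟩⟩
      simp only [Finset.mem_sigma, Finset.HasAntidiagonal.mem_antidiagonal]
      rintro ⟨-, rfl⟩
      rfl
    · rintro ⟨⟨a, b⟩, ⟨c, d⟩⟩ _
      rfl
  · push Not at hn
    simp only [if_neg (hn _), Finset.sum_const_zero]

/-- Every element agrees below any given order with a finite sum of monomials. -/
theorem exists_finite_approx {q : SkewLaurent N δ} {a : ℤ} (hq : q.ValGE a) (u : ℤ) :
    ∃ s : Finset ℤ, (∀ i ∈ s, a ≤ i) ∧
      (q - ∑ i ∈ s, single i (q.coeff i)).ValGE u := by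
  refine ⟨Finset.Ico a u, fun i hi => (Finset.mem_Ico.1 hi).1, fun m hm => ?_⟩
  rw [coeff_sub, coeff_sum]
  simp only [coeff_single]
  rw [Finset.sum_ite_eq]
  split_ifs with h
  · exact sub_self _
  · rw [hq m (by rw [Finset.mem_Ico] at h; omega), sub_zero]

theorem valGE_sum {ι : Type*} {s : Finset ι} {q : ι → SkewLaurent N δ} {a : ℤ}
    (h : ∀ i ∈ s, (q i).ValGE a) : (∑ i ∈ s, q i).ValGE a := fun m hm => by
  rw [coeff_sum]
  exact Finset.sum_eq_zero fun i hi => h i hi m hm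

theorem mul_assoc' (q p r : SkewLaurent N δ) : q * p * r = q * (p * r) := by
  ext m
  obtain ⟨a, ha⟩ := q.exists_valGE
  obtain ⟨b, hb⟩ := p.exists_valGE
  obtain ⟨c, hc⟩ := r.exists_valGE
  obtain ⟨s, hs, hs'⟩ := exists_finite_approx ha (m + 1 - b - c)
  obtain ⟨t, ht, ht'⟩ := exists_finite_approx hb (m + 1 - a - c)
  obtain ⟨v, hv, hv'⟩ := exists_finite_approx hc (m + 1 - a - b)
  set q' := ∑ i ∈ s, (single i (q.coeff i) : SkewLaurent N δ) with hq'
  set p' := ∑ i ∈ t, (single i (p.coeff i) : SkewLaurent N δ) with hp'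
  set r' := ∑ i ∈ v, (single i (r.coeff i) : SkewLaurent N δ) with hr'
  have ha' : q'.ValGE a := valGE_sum fun i hi => (valGE_single i _).mono (hs i hi)
  have hb' : p'.ValGE b := valGE_sum fun i hi => (valGE_single i _).mono (ht i hi)
  have main : q' * p' * r' = q' * (p' * r') := by
    simp only [hq', hp', hr', Finset.sum_mul, Finset.mul_sum, single_mul_assoc]
  have e1 : q * p * r = (q - q') * p * r + q' * (p - p') * r + q' * p' * (r - r') +
      q' * p' * r' := by
    simp only [sub_mul, mul_sub]; abel
  have e2 : q * (p * r) = (q - q') * (p * r) + q' * ((p - p') * r) + q' * (p' * (r - r')) +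
      q' * (p' * r') := by
    simp only [sub_mul, mul_sub]; abel
  rw [e1, e2, main]
  simp only [coeff_add]
  rw [((hs'.mul hb).mul hc) m (by omega), ((ha'.mul ht').mul hc) m (by omega),
    ((ha'.mul hb').mul hv') m (by omega), (hs'.mul (hb.mul hc)) m (by omega),
    (ha'.mul (ht'.mul hc)) m (by omega), (ha'.mul (hb'.mul hv')) m (by omega)]

noncomputable instance : Ring (SkewLaurent N δ) where
  __ := (inferInstance : NonUnitalNonAssocRing (SkewLaurent N δ))
  mul_assoc := mul_assoc'
  one_mul := one_mul'
  mul_one := mul_one'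

end ring
end SkewLaurent

/-- The homographic transformation `z ↦ (a z + b) / (c z + d)`. -/
noncomputable def moebius (γ : Matrix.SpecialLinearGroup (Fin 2) ℂ) (z : ℂ) : ℂ :=
  (γ 0 0 * z + γ 0 1) / (γ 1 0 * z + γ 1 1)

/-- The function `z ↦ c z + d`. -/
def denomFun (γ : Matrix.SpecialLinearGroup (Fin 2) ℂ) (z : ℂ) : ℂ := γ 1 0 * z + γ 1 1

noncomputable instance germAlgebra (l : Filter ℂ) : Algebra ℂ (Germ l ℂ) :=
  Algebra.ofModule
    (fun r x y => Germ.inductionOn₂ x y fun f g => by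
      rw [← Germ.coe_smul, ← Germ.coe_mul, ← Germ.coe_mul, ← Germ.coe_smul, smul_mul_assoc])
    (fun r x y => Germ.inductionOn₂ x y fun f g => by
      rw [← Germ.coe_smul, ← Germ.coe_mul, ← Germ.coe_mul, ← Germ.coe_smul, mul_smul_comm])

/-- A commutative `ℂ`-algebra `R` of functions in one complex variable `z` on which a subgroup
`Γ` of `SL(2, ℂ)` acts by homographies.

Functions are considered on the members of a filter `l` on `ℂ` which has a basis of open sets;
they are complex differentiable on a member of `l`, and are identified when they agree on a member
of `l`. With `l = 𝓟 U` for `U` open, one has functions on `U` in the plain sense (for instance all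
holomorphic functions on the upper half-plane); `l = codiscreteWithin U` accommodates algebras of
meromorphic functions on `U`, and `l = cofinite` the field of rational functions. -/
structure HomographicAlgebra (Γ : Subgroup (Matrix.SpecialLinearGroup (Fin 2) ℂ)) where
  /-- the filter of domains of the functions -/
  l : Filter ℂ
  exists_isOpen : ∀ s ∈ l, ∃ u ∈ l, IsOpen u ∧ u ⊆ s
  tendsto_moebius : ∀ γ ∈ Γ, Tendsto (moebius γ) l l
  /-- the algebra `R` -/
  R : Subalgebra ℂ (Germ l ℂ)
  isDomain : IsDomain R
  differentiable : ∀ f : ℂ → ℂ, (f : Germ l ℂ) ∈ R → ∀ᶠ z in l, DifferentiableAt ℂ f z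
  comp_moebius_mem : ∀ γ ∈ Γ, ∀ f : ℂ → ℂ, (f : Germ l ℂ) ∈ R →
    ((fun z => f (moebius γ z) : ℂ → ℂ) : Germ l ℂ) ∈ R
  denom_mem : ∀ γ ∈ Γ, (denomFun γ : Germ l ℂ) ∈ R
  isUnit_denom : ∀ γ, ∀ h : γ ∈ Γ, IsUnit (⟨(denomFun γ : Germ l ℂ), denom_mem γ h⟩ : R)
  deriv_mem : ∀ f : ℂ → ℂ, (f : Germ l ℂ) ∈ R → (deriv f : Germ l ℂ) ∈ R

namespace HomographicAlgebra

variable {Γ : Subgroup (Matrix.SpecialLinearGroup (Fin 2) ℂ)} (A : HomographicAlgebra Γ)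

theorem eventually_nhds {p : ℂ → Prop} (h : ∀ᶠ z in A.l, p z) : ∀ᶠ z in A.l, ∀ᶠ w in 𝓝 z, p w := by
  obtain ⟨u, hu, hu', hs⟩ := A.exists_isOpen _ h
  exact mem_of_superset hu fun z hz => mem_of_superset (hu'.mem_nhds hz) hs

/-- The derivative of a function modulo equality along the filter. -/
noncomputable def derivGerm : Germ A.l ℂ → Germ A.l ℂ :=
  Quotient.map' (deriv : (ℂ → ℂ) → ℂ → ℂ) fun _ _ h =>
    (A.eventually_nhds h).mono fun _ hz => EventuallyEq.deriv_eq hz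

theorem derivGerm_coe (f : ℂ → ℂ) : A.derivGerm (f : Germ A.l ℂ) = (deriv f : Germ A.l ℂ) := rfl

/-- The standard derivation `∂_z` of `R`. -/
noncomputable def dz : Derivation ℂ A.R A.R :=
  Derivation.mk'
    { toFun := fun f => ⟨A.derivGerm f, by
        obtain ⟨f, hf⟩ := f
        induction f using Germ.inductionOn with
        | _ f => exact A.deriv_mem f hf⟩
      map_add' := by
        rintro ⟨f, hf⟩ ⟨g, hg⟩
        induction f using Germ.inductionOn with
        | _ f =>
        induction g using Germ.inductionOn with
        | _ g =>
        refine Subtype.ext (Germ.coe_eq.2 ?_)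
        filter_upwards [A.differentiable f hf, A.differentiable g hg] with z h1 h2
        exact deriv_add h1 h2
      map_smul' := by
        rintro c ⟨f, hf⟩
        induction f using Germ.inductionOn with
        | _ f =>
        refine Subtype.ext (Germ.coe_eq.2 ?_)
        filter_upwards [A.differentiable f hf] with z h1
        exact deriv_const_smul c h1 }
    (by
      rintro ⟨f, hf⟩ ⟨g, hg⟩
      induction f using Germ.inductionOn with
      | _ f =>
      induction g using Germ.inductionOn with
      | _ g =>
      refine Subtype.ext (Germ.coe_eq.2 ?_)
      filter_upwards [A.differentiable f hf, A.differentiable g hg] with z h1 h2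
      refine (deriv_mul h1 h2).trans ?_
      change deriv f z * g z + f z * deriv g z = f z * deriv g z + g z * deriv f z
      ring)

theorem coe_dz (f : A.R) : ((A.dz f : A.R) : Germ A.l ℂ) = A.derivGerm f := rfl

/-- The right homographic action `(f · γ)(z) = f ((a z + b) / (c z + d))`. -/
noncomputable def act (γ : Γ) (f : A.R) : A.R :=
  ⟨(f : Germ A.l ℂ).compTendsto (moebius γ) (A.tendsto_moebius γ γ.2), by
    obtain ⟨f, hf⟩ := f
    induction f using Germ.inductionOn with
    | _ f => exact A.comp_moebius_mem γ γ.2 f hf⟩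

/-- The element `s_γ : z ↦ c z + d` of the group of units of `R`. -/
noncomputable def s (γ : Γ) : A.Rˣ := (A.isUnit_denom γ γ.2).unit

theorem coe_s (γ : Γ) : (((A.s γ : A.Rˣ) : A.R) : Germ A.l ℂ) = (denomFun γ : Germ A.l ℂ) := rfl

/-- The ring `B = R((x; -∂_z))`: here `x f = ∑_k (-∂_z)^k(f) x ^ (k + 1)`. -/
abbrev B : Type := SkewLaurent 1 (-A.dz)

/-- The ring `C = R((y; -∂_z / 2))₂`: here
`y f = ∑_k (2k)! / (2 ^ k (k!) ^ 2) (-∂_z / 2)^k(f) y ^ (2 k + 1)`. -/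
abbrev C : Type := SkewLaurent 2 ((1 / 2 : ℂ) • (-A.dz))

/-- The inclusion of `B` in `C` given by `x = y ^ 2`. -/
noncomputable def inclusion (q : A.B) : A.C where
  coeff m := if Even m then q.coeff (m / 2) else 0
  bddBelow' := by
    obtain ⟨a, ha⟩ := q.bddBelow'
    refine ⟨2 * a, fun i hi => ?_⟩
    split_ifs
    · exact ha _ (by omega)
    · rfl

/-- The maps `q ↦ q · γ` form a right action of `Γ` by automorphisms on `B` which extends the
homographic action on `R` and satisfies `x⁻¹ · γ = (c z + d) ^ 2 x⁻¹`. -/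
structure IsExtensionB (ρ : Γ → (A.B ≃+* A.B)) : Prop where
  mul_act : ∀ γ γ' q, ρ (γ * γ') q = ρ γ' (ρ γ q)
  act_const : ∀ γ f, ρ γ (SkewLaurent.single 0 f) = SkewLaurent.single 0 (A.act γ f)
  act_x_inv : ∀ γ, ρ γ (SkewLaurent.single (-1) 1) =
    SkewLaurent.single (-1) ((A.s γ : A.R) ^ 2)

/-- The maps `q ↦ q · γ` form a right action of `Γ` by automorphisms on `C` which extends the
homographic action on `R` and for which `y · γ` is the square root of `x (c z + d)⁻²`, where
`x = y ^ 2`, whose term of minimal valuation is `(c z + d)⁻¹ y`. -/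
structure IsExtensionC (ρ : Γ → (A.C ≃+* A.C)) : Prop where
  mul_act : ∀ γ γ' q, ρ (γ * γ') q = ρ γ' (ρ γ q)
  act_const : ∀ γ f, ρ γ (SkewLaurent.single 0 f) = SkewLaurent.single 0 (A.act γ f)
  act_y_sq : ∀ γ, ρ γ (SkewLaurent.single 1 1) ^ 2 =
    SkewLaurent.single 2 1 * SkewLaurent.single 0 (((A.s γ)⁻¹ : A.Rˣ) : A.R) ^ 2
  act_y_valuation : ∀ γ, (ρ γ (SkewLaurent.single 1 1)).ValGE 1
  act_y_leading : ∀ γ, (ρ γ (SkewLaurent.single 1 1)).coeff 1 = (((A.s γ)⁻¹ : A.Rˣ) : A.R)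

/-- The element `c / (c z + d)` of `R`. -/
noncomputable def ratio (γ : Γ) : A.R :=
  ((γ : Matrix.SpecialLinearGroup (Fin 2) ℂ) 1 0) • (((A.s γ)⁻¹ : A.Rˣ) : A.R)

end HomographicAlgebra

/-! Both rings are cases of one construction with parameter `N`: `N = 1` for `B`, `N = 2` for `C`,
with `N δ = -∂_z`. In either case the action is produced by an explicit formula, in which `f X ^ i`
goes to `φ(f) ∑ᵤ P_u(i / N) c ^ u s ^ (-(e i) - u) X ^ (i + N u)`. Here `φ` is the homographic
action on `R`, `s = c z + d`, `P_u(σ) = (σ)_u (σ + 1)_u / u!` and `e N = 2`, so that `X ^ (-N)` goes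
to `s ^ 2 X ^ (-N)`. What must be shown is that this additive map is multiplicative and that it
respects composition in `Γ`.

The commutation law of `X ^ (-N)` has only two terms, `X ^ (-N) f = f X ^ (-N) + ∂_z f`.
Compatibility with left multiplication by `X ^ (-N)` thus reduces to the chain rule `s ^ 2 ∂_z(φ f)
= φ(∂_z f)`, to `∂_z s = c`, and to the recurrence `powCoeff_succ_sub` (`transform_single_neg_mul`).
Induction then gives `X ^ (-N n)` for every natural `n`. All other powers, odd powers of `y`
included, follow by interpolation. After multiplication by the `i`-th power of a fixed unit, the
coefficients at offset `M` from `i` on both sides are polynomial in `i`; they agree for infinitely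
many `i`, and `R` is a domain of characteristic zero (`PolyFam.ext`). Additivity and control of the
valuation pass from monomials to series (`addMonoidHom_ext`). The same interpolation proves
`transform_transform`, from the cocycle relation for `s`.

The formulas hold for every extension because the image of the generator is forced: `x · γ` is the
inverse of `x⁻¹ · γ`, and a square root with prescribed unit leading coefficient is unique
(`eq_of_sq_eq_sq`). The numerical coefficients are then `P_n(1)` and `P_u(1 / 2)`. -/

namespace SkewLaurent

open Polynomial

/-! ### Polynomial dependence on an integer exponent. -/

/-- The function `F` of an integer is given by a polynomial with coefficients in `R`. -/
def IsPoly {R : Type*} [CommRing R] (F : ℤ → R) : Prop := ∃ p : R[X], ∀ i : ℤ, F i = p.eval (i : R)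

namespace IsPoly

variable {R : Type*} [CommRing R]

theorem const (r : R) : IsPoly fun _ => r := ⟨C r, fun _ => by simp⟩

theorem intCast : IsPoly fun i => (i : R) := ⟨X, fun _ => by simp⟩

theorem add {F G : ℤ → R} (hF : IsPoly F) (hG : IsPoly G) : IsPoly fun i => F i + G i := by
  obtain ⟨p, hp⟩ := hF
  obtain ⟨q, hq⟩ := hG
  exact ⟨p + q, fun i => by simp only [hp, hq, eval_add]⟩

theorem mul {F G : ℤ → R} (hF : IsPoly F) (hG : IsPoly G) : IsPoly fun i => F i * G i := by
  obtain ⟨p, hp⟩ := hF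
  obtain ⟨q, hq⟩ := hG
  exact ⟨p * q, fun i => by simp only [hp, hq, eval_mul]⟩

theorem sum {ι : Type*} (s : Finset ι) {F : ι → ℤ → R} (h : ∀ j ∈ s, IsPoly (F j)) :
    IsPoly fun i => ∑ j ∈ s, F j i := by
  choose! p hp using h
  exact ⟨∑ j ∈ s, p j, fun i => by
    rw [eval_finsetSum]; exact Finset.sum_congr rfl fun j hj => hp j hj i⟩

theorem prod {ι : Type*} (s : Finset ι) {F : ι → ℤ → R} (h : ∀ j ∈ s, IsPoly (F j)) :
    IsPoly fun i => ∏ j ∈ s, F j i := by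
  choose! p hp using h
  exact ⟨∏ j ∈ s, p j, fun i => by
    rw [eval_prod]; exact Finset.prod_congr rfl fun j hj => hp j hj i⟩

theorem map {S : Type*} [CommRing S] (φ : R →+* S) {F : ℤ → R} (hF : IsPoly F) :
    IsPoly fun i => φ (F i) := by
  obtain ⟨p, hp⟩ := hF
  exact ⟨p.map φ, fun i => by simp only [hp]; rw [← map_intCast φ, eval_map_apply]⟩

theorem smul [Algebra ℂ R] {g : ℤ → ℂ} {F : ℤ → R} (hg : IsPoly g) (hF : IsPoly F) :
    IsPoly fun i => g i • F i := by
  simp only [Algebra.smul_def]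
  exact (hg.map (algebraMap ℂ R)).mul hF

theorem eq_of_infinite [IsDomain R] [CharZero R] {F G : ℤ → R} (hF : IsPoly F) (hG : IsPoly G)
    {S : Set ℤ} (hS : S.Infinite) (h : ∀ i ∈ S, F i = G i) (i : ℤ) : F i = G i := by
  obtain ⟨p, hp⟩ := hF
  obtain ⟨q, hq⟩ := hG
  have : p = q := by
    refine eq_of_infinite_eval_eq p q ((hS.image (Int.cast_injective (α := R)).injOn).mono ?_)
    rintro _ ⟨j, hj, rfl⟩
    rw [Set.mem_ofPred_eq, ← hp, ← hq, h j hj]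
  rw [hp, hq, this]

end IsPoly

theorem isPoly_twistCoeff (N : ℕ) (l : ℤ) (k : ℕ) :
    IsPoly fun i : ℤ => twistCoeff N ((i + l : ℤ) : ℂ) k := by
  unfold twistCoeff
  refine IsPoly.prod _ fun j _ => ?_
  simp only [div_eq_mul_inv]
  refine IsPoly.mul (IsPoly.add ?_ (.const _)) (.const _)
  push_cast
  exact IsPoly.intCast.add (.const _)

/-! ### The coefficients `P_u` and their recurrences. -/

/-- The coefficient `P_u(σ) = (σ)_u (σ + 1)_u / u!` in the homographic transform of a power. -/
noncomputable def powCoeff (u : ℕ) (σ : ℂ) : ℂ :=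
  ∏ j ∈ Finset.range u, (σ + j) * (σ + 1 + j) / (j + 1)

theorem powCoeff_zero (σ : ℂ) : powCoeff 0 σ = 1 := by simp [powCoeff]

theorem powCoeff_neg_one {u : ℕ} (hu : u ≠ 0) : powCoeff u (-1) = 0 := by
  refine Finset.prod_eq_zero (i := 0) (by simpa using Nat.pos_of_ne_zero hu) (by simp)

theorem powCoeff_zero_right {u : ℕ} (hu : u ≠ 0) : powCoeff u 0 = 0 := by
  refine Finset.prod_eq_zero (i := 0) (by simpa using Nat.pos_of_ne_zero hu) (by simp)

/-- This is `σ (σ + 1)_u = (σ + u) (σ)_u` applied to both Pochhammer factors. It is kept free of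
division so that it holds at `σ = 0` and `σ = -1` too. -/
theorem powCoeff_shift (u : ℕ) (σ : ℂ) :
    σ * (σ + 1) * powCoeff u (σ + 1) = (σ + u) * (σ + 1 + u) * powCoeff u σ := by
  induction u with
  | zero => simp [powCoeff_zero]
  | succ u ih =>
    have h0 : (u : ℂ) + 1 ≠ 0 := Nat.cast_add_one_ne_zero u
    have h (τ : ℂ) : powCoeff (u + 1) τ = powCoeff u τ * ((τ + u) * (τ + 1 + u) / (u + 1)) := by
      rw [powCoeff, Finset.prod_range_succ, ← powCoeff]
    rw [h, h]
    field_simp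
    push_cast
    linear_combination ((σ + 1 + u) * (σ + 1 + 1 + u)) * ih

theorem powCoeff_succ_left (u : ℕ) (σ : ℂ) :
    powCoeff (u + 1) σ = powCoeff u (σ + 1) * (σ * (σ + 1) / (u + 1)) := by
  have h0 : (u : ℂ) + 1 ≠ 0 := Nat.cast_add_one_ne_zero u
  rw [powCoeff, Finset.prod_range_succ, ← powCoeff]
  field_simp
  linear_combination -powCoeff_shift u σ

/-- This recurrence is what compatibility with `X ^ (-N)` demands. With `σ + 1 = i / N`, the factor
`-(u + 2 + 2 σ)` is the exponent `-(e i) - u` of `s`, brought down by differentiating that power. -/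
theorem powCoeff_succ_sub (u : ℕ) (σ : ℂ) :
    powCoeff (u + 1) σ = powCoeff (u + 1) (σ + 1) - (u + 2 + 2 * σ) * powCoeff u (σ + 1) := by
  have h0 : (u : ℂ) + 1 ≠ 0 := Nat.cast_add_one_ne_zero u
  rw [powCoeff_succ_left, powCoeff, powCoeff, Finset.prod_range_succ, ← powCoeff]
  field_simp
  ring

theorem isPoly_powCoeff (u : ℕ) (b d : ℂ) :
    IsPoly fun i : ℤ => powCoeff u ((i + b) / d - u) := by
  unfold powCoeff
  refine IsPoly.prod _ fun j _ => ?_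
  simp only [div_eq_mul_inv, sub_eq_add_neg]
  have h : IsPoly fun i : ℤ => ((i : ℂ) + b) * d⁻¹ + -(u : ℂ) :=
    ((IsPoly.intCast.add (.const _)).mul (.const _)).add (.const _)
  exact ((h.add (.const _)).mul ((h.add (.const _)).add (.const _))).mul (.const _)

/-! ### Changes of variable and the transform of series. -/

/-- A change of variable for the derivation `D`: an endomorphism `φ` of `R` such that
`D ∘ φ = s⁻² (φ ∘ D)`, where `D s = c` is constant. -/
structure ChangeOfVariable {R : Type*} [CommRing R] [Algebra ℂ R] (D : Derivation ℂ R R) where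
  /-- the endomorphism of `R` -/
  φ : R →ₐ[ℂ] R
  /-- the denominator -/
  s : Rˣ
  /-- the derivative of the denominator -/
  c : ℂ
  map_s : D (s : R) = algebraMap ℂ R c
  comm : ∀ f, (s : R) ^ 2 * D (φ f) = φ (D f)

variable {N : ℕ} {R : Type*} [CommRing R] [Algebra ℂ R] {δ D : Derivation ℂ R R}

theorem ChangeOfVariable.map_s_zpow (T : ChangeOfVariable D) (n : ℤ) :
    D ((T.s ^ n : Rˣ) : R) = (n * T.c : ℂ) • ((T.s ^ (n - 1) : Rˣ) : R) := by
  have key : ∀ m : ℤ, D ((T.s ^ (m + 1) : Rˣ) : R) =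
      ((T.s ^ m : Rˣ) : R) * algebraMap ℂ R T.c + T.s * D ((T.s ^ m : Rˣ) : R) := fun m => by
    rw [zpow_add_one, Units.val_mul, D.leibniz, T.map_s, smul_eq_mul, smul_eq_mul]
  induction n using Int.induction_on with
  | zero => simp
  | succ n ih =>
    have e : (T.s : R) * ((T.s ^ ((n : ℤ) - 1) : Rˣ) : R) = ((T.s ^ (n : ℤ) : Rˣ) : R) := by
      rw [← Units.val_mul, ← zpow_one_add]; congr 2; ring
    rw [key, ih, mul_smul_comm, e, add_sub_cancel_right]
    simp only [Algebra.smul_def, map_mul, Int.cast_add, map_add, Int.cast_one, map_one]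
    ring
  | pred n ih =>
    have h := key (-n - 1)
    rw [sub_add_cancel, ih] at h
    have e : (T.s : R) * ((T.s ^ (-(n : ℤ) - 1 - 1) : Rˣ) : R) =
        ((T.s ^ (-(n : ℤ) - 1) : Rˣ) : R) := by
      rw [← Units.val_mul, ← zpow_one_add]; congr 2; ring
    refine T.s.isUnit.mul_left_cancel ?_
    rw [mul_smul_comm, e]
    simp only [Algebra.smul_def, map_mul, Int.cast_sub, map_sub, Int.cast_one, map_one] at h ⊢
    linear_combination -h

/-- The formal series transform extending a change of variable, with `X ^ i` sent to
`∑ᵤ P_u(i / N) c ^ u s ^ (-(e i) - u) X ^ (i + N u)`, where `e N = 2`. -/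
noncomputable def transform (T : ChangeOfVariable D) (e : ℤ) (q : SkewLaurent N δ) :
    SkewLaurent N δ where
  coeff m := ∑ᶠ u : ℕ, (powCoeff u (m / N - u) * T.c ^ u) •
    (T.φ (q.coeff (m - N * u)) * ((T.s ^ (u - e * m) : Rˣ) : R))
  bddBelow' := by
    obtain ⟨a, ha⟩ := q.exists_valGE
    refine ⟨a, fun m hm => finsum_eq_zero_of_forall_eq_zero fun u => ?_⟩
    have : (0 : ℤ) ≤ N * u := by positivity
    rw [ha _ (by omega), map_zero, zero_mul, smul_zero]

section

variable [NeZero N] (T : ChangeOfVariable D) (e : ℤ)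

theorem coeff_transform {q : SkewLaurent N δ} {a : ℤ} (hq : q.ValGE a) (m : ℤ) (K : ℕ)
    (hK : m - a < K) : (transform T e q).coeff m =
      ∑ u ∈ Finset.range K, (powCoeff u (m / N - u) * T.c ^ u) •
        (T.φ (q.coeff (m - N * u)) * ((T.s ^ (u - e * m) : Rˣ) : R)) := by
  refine finsum_eq_sum_of_support_subset _ fun u hu => ?_
  by_contra h
  refine hu ?_
  rw [Finset.coe_range, Set.mem_Iio, not_lt] at h
  have hN : (1 : ℤ) ≤ N := by exact_mod_cast Nat.one_le_iff_ne_zero.2 (NeZero.ne N)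
  have h2 : (u : ℤ) ≤ N * u := le_mul_of_one_le_left (by positivity) hN
  change _ • (T.φ (q.coeff (m - N * u)) * _) = 0
  rw [hq _ (by omega), map_zero, zero_mul, smul_zero]

theorem ValGE.transform {q : SkewLaurent N δ} {a : ℤ} (hq : q.ValGE a) :
    (transform T e q).ValGE a := fun m hm => by
  rw [coeff_transform T e hq m 0 (by simpa using hm), Finset.sum_range_zero]

theorem transform_add (q p : SkewLaurent N δ) :
    transform T e (q + p) = transform T e q + transform T e p := by
  ext m
  obtain ⟨a, ha⟩ := q.exists_valGE
  obtain ⟨b, hb⟩ := p.exists_valGE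
  have ha' := ha.mono (min_le_left a b)
  have hb' := hb.mono (min_le_right a b)
  have hs : (q + p).ValGE (min a b) := fun i hi => by rw [coeff_add, ha' i hi, hb' i hi, add_zero]
  have h : m - min a b < ((m - min a b).toNat + 1 : ℕ) := by omega
  rw [coeff_add, coeff_transform T e ha' m _ h, coeff_transform T e hb' m _ h,
    coeff_transform T e hs m _ h, ← Finset.sum_add_distrib]
  simp only [coeff_add, map_add, add_mul, smul_add]

theorem coeff_single_zero_mul (f : R) (p : SkewLaurent N δ) (m : ℤ) :
    (single 0 f * p).coeff m = f * p.coeff m := by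
  obtain ⟨b, hb⟩ := p.exists_valGE
  rw [coeff_single_mul 0 f hb m ((m - b).toNat + 1) (by omega), Finset.sum_eq_single 0]
  · simp [twistCoeff]
  · intro k _ hk
    rw [Int.cast_zero, twistCoeff_zero_left N k hk, zero_smul]
  · simp

theorem single_mul_single_one (i j : ℤ) (f : R) :
    (single i f * single j 1 : SkewLaurent N δ) = single (i + j) f := by
  ext m
  rw [coeff_single_mul i f (valGE_single j 1) m ((m - j - i).toNat + 1) (by omega),
    Finset.sum_eq_single 0]
  · simp only [coeff_single, twistCoeff, Finset.range_zero, Finset.prod_empty, one_smul,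
      Function.iterate_zero, id, Nat.cast_zero, mul_zero, sub_zero]
    by_cases h : m = i + j
    · rw [if_pos (by omega), if_pos h, mul_one]
    · rw [if_neg (by omega), if_neg h, mul_zero]
  · intro k _ hk
    obtain ⟨k, rfl⟩ := Nat.exists_eq_succ_of_ne_zero hk
    rw [coeff_single, Function.iterate_succ_apply]
    split_ifs
    · rw [Derivation.map_one_eq_zero, iter_zero, mul_zero, smul_zero]
    · rw [map_zero, iter_zero, mul_zero, smul_zero]
  · simp

theorem transform_single_zero_mul (f : R) (q : SkewLaurent N δ) :
    transform T e (single 0 f * q) = single 0 (T.φ f) * transform T e q := by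
  ext m
  obtain ⟨a, ha⟩ := q.exists_valGE
  have h : m - a < ((m - a).toNat + 1 : ℕ) := by omega
  have ha' : (single 0 f * q).ValGE a := by simpa using (valGE_single 0 f).mul ha
  rw [coeff_single_zero_mul, coeff_transform T e ha m _ h, coeff_transform T e ha' m _ h,
    Finset.mul_sum]
  refine Finset.sum_congr rfl fun u _ => ?_
  rw [coeff_single_zero_mul, map_mul, mul_smul_comm, mul_assoc]

/-- Only `u = 0` survives, since `P_u(0) = 0` for `u ≥ 1`. -/
theorem transform_single_zero (f : R) :
    transform T e (single 0 f : SkewLaurent N δ) = single 0 (T.φ f) := by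
  ext m
  rw [coeff_transform T e (valGE_single 0 f) m (m.toNat + 1) (by omega), Finset.sum_eq_single 0]
  · by_cases h : m = 0
    · simp [h, coeff_single, powCoeff_zero]
    · simp [h, coeff_single]
  · intro u _ hu
    rw [coeff_single]
    have hN : (N : ℂ) ≠ 0 := by exact_mod_cast NeZero.ne N
    split_ifs with h
    · have : ((m : ℂ) / N - u) = 0 := by
        have h' : (m : ℂ) = N * u := by exact_mod_cast sub_eq_zero.1 h
        rw [h', mul_div_cancel_left₀ _ hN, sub_self]
      rw [this, powCoeff_zero_right hu, zero_mul, zero_smul]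
    · rw [map_zero, zero_mul, smul_zero]
  · simp

/-- Only `u = 0` survives, since `P_u(-1) = 0` for `u ≥ 1`; the exponent of `s` is then `e N = 2`.
-/
theorem transform_single_neg (he : e * N = 2) :
    transform T e (single (-N) 1 : SkewLaurent N δ) = single (-N) ((T.s : R) ^ 2) := by
  ext m
  rw [coeff_transform T e (valGE_single (-N) 1) m ((m + N).toNat + 1) (by omega),
    Finset.sum_eq_single 0]
  · by_cases h : m = -N
    · subst h
      simp [coeff_single, powCoeff_zero, he]
    · simp [h, coeff_single]
  · intro u _ hu
    rw [coeff_single]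
    have hN : (N : ℂ) ≠ 0 := by exact_mod_cast NeZero.ne N
    split_ifs with h
    · have : ((m : ℂ) / N - u) = -1 := by
        have h' : (m : ℂ) = N * u - N := by exact_mod_cast (by linarith : m = N * u - N)
        rw [h']; field_simp; ring
      rw [this, powCoeff_neg_one hu, zero_mul, zero_smul]
    · rw [map_zero, zero_mul, smul_zero]
  · simp

/-- The commutation law of `X ^ (-N)` stops after two terms: `c_1(-N) δ = -N δ = D`, and `c_k(-N) =
0` for `k ≥ 2`. -/
theorem coeff_single_neg_mul (hδ : (N : ℂ) • δ = -D) (f : R) (q : SkewLaurent N δ) (m : ℤ) :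
    (single (-N) f * q).coeff m = f * (q.coeff (m + N) + D (q.coeff m)) := by
  obtain ⟨a, ha⟩ := q.exists_valGE
  have hD : ∀ g, D g = -((N : ℂ) • δ g) := fun g => by
    rw [← Derivation.smul_apply, hδ, Derivation.neg_apply, neg_neg]
  rw [coeff_single_mul (-N) f ha m ((m - a + N).toNat + 2) (by omega), Finset.sum_range_succ',
    Finset.sum_range_succ', Finset.sum_eq_zero]
  · simp [twistCoeff, hD, mul_add, add_comm]
  · intro k _
    -- The factor of index `1` in the product is `-N + N · 1 = 0`.
    have : twistCoeff N ((-(N : ℤ) : ℤ) : ℂ) (k + 1 + 1) = 0 :=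
      Finset.prod_eq_zero (i := 1) (by simp) (by simp)
    rw [this, zero_smul]

/-- The coefficient of `X ^ m` on each side splits into terms in `φ(D q_j)`, which match by the
chain rule, and terms in `φ(q_j)`, which match by the recurrence for `P_u`. -/
theorem transform_single_neg_mul (hδ : (N : ℂ) • δ = -D) (he : e * N = 2)
    (q : SkewLaurent N δ) : transform T e (single (-N) 1 * q) =
      transform T e (single (-N) 1) * transform T e q := by
  have hN : (N : ℂ) ≠ 0 := by exact_mod_cast NeZero.ne N
  have hN' : (0 : ℤ) ≤ N := by positivity
  have heC : (e : ℂ) * N = 2 := by exact_mod_cast he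
  rw [transform_single_neg T e he]
  ext m
  obtain ⟨a, ha⟩ := q.exists_valGE
  have ha' : (single (-N) 1 * q).ValGE (-N + a) := (valGE_single _ _).mul ha
  set K : ℕ := (m - a + N).toNat + 1 with hK
  rw [coeff_single_neg_mul hδ, coeff_transform T e ha' m (K + 1) (by omega),
    coeff_transform T e ha (m + N) (K + 1) (by omega), coeff_transform T e ha m K (by omega)]
  simp only [coeff_single_neg_mul hδ, one_mul, map_add, add_mul, smul_add, Finset.sum_add_distrib]
  -- The terms in `D q_j` need one summand fewer: at `u = K` the index `m - N K` is below the order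
  -- of `q`.
  have e2 : ∑ u ∈ Finset.range (K + 1), (powCoeff u (m / N - u) * T.c ^ u) •
        (T.φ (D (q.coeff (m - N * u))) * ((T.s ^ (u - e * m) : Rˣ) : R)) =
      ∑ u ∈ Finset.range K, (powCoeff u (m / N - u) * T.c ^ u) •
        (T.φ (D (q.coeff (m - N * u))) * ((T.s ^ (u - e * m) : Rˣ) : R)) := by
    have h1 : (1 : ℤ) ≤ N := by exact_mod_cast Nat.one_le_iff_ne_zero.2 (NeZero.ne N)
    have h2 : (K : ℤ) ≤ N * K := le_mul_of_one_le_left (by positivity) h1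
    rw [Finset.sum_range_succ, ha (m - N * K) (by omega), map_zero, map_zero, zero_mul, smul_zero,
      add_zero]
  -- Leibniz on `φ(q_j) s ^ n`: `T.comm` turns the first part into `φ(D q_j)`, while `D(s ^ n) = n c
  -- s ^ (n - 1)` gives the second. That part carries an extra `c`, so it is written at level `u +
  -- 1`.
  have e3 : (T.s : R) ^ 2 * D (∑ u ∈ Finset.range K, (powCoeff u (m / N - u) * T.c ^ u) •
        (T.φ (q.coeff (m - N * u)) * ((T.s ^ (u - e * m) : Rˣ) : R))) =
      ∑ u ∈ Finset.range K, (powCoeff u (m / N - u) * T.c ^ u) •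
        (T.φ (D (q.coeff (m - N * u))) * ((T.s ^ (u - e * m) : Rˣ) : R)) +
      ∑ u ∈ Finset.range K, (powCoeff u (m / N - u) * T.c ^ u * ((u - e * m : ℤ) * T.c)) •
        (T.φ (q.coeff (m + N - N * (u + 1 : ℕ))) *
          ((T.s ^ ((u + 1 : ℕ) - e * m) : Rˣ) : R)) := by
    rw [map_sum, Finset.mul_sum, ← Finset.sum_add_distrib]
    refine Finset.sum_congr rfl fun u _ => ?_
    have hs : ((T.s ^ ((u + 1 : ℕ) - e * m) : Rˣ) : R) =
        (T.s : R) ^ 2 * ((T.s ^ (u - e * m - 1) : Rˣ) : R) := by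
      rw [← Units.val_pow_eq_pow_val, ← Units.val_mul, ← zpow_natCast, ← zpow_add]
      congr 2; push_cast; ring
    have hi : m + N - N * (u + 1 : ℕ) = m - N * u := by push_cast; ring
    rw [D.map_smul, D.leibniz, T.map_s_zpow, hs, hi, ← T.comm]
    simp only [smul_eq_mul, Algebra.smul_def, map_mul]
    ring
  have e4 : ∀ u : ℕ, (T.s : R) ^ 2 * ((T.s ^ (u - e * (m + N)) : Rˣ) : R) =
      ((T.s ^ (u - e * m) : Rˣ) : R) := fun u => by
    rw [← Units.val_pow_eq_pow_val, ← Units.val_mul, ← zpow_natCast, ← zpow_add]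
    congr 2; push_cast; linear_combination -he
  rw [e2, mul_add, e3, Finset.mul_sum, add_comm, add_left_comm]
  congr 1
  -- The terms in `φ(D q_j)` are gone. Splitting off `u = 0`, where `P_0 = 1`, aligns level `u + 1`
  -- of the shifted series with level `u` of the derivative.
  rw [Finset.sum_range_succ', Finset.sum_range_succ' (n := K), add_right_comm,
    ← Finset.sum_add_distrib]
  simp only [mul_smul_comm, mul_left_comm _ (T.φ _), e4]
  congr 1
  · refine Finset.sum_congr rfl fun u _ => ?_
    have hi : m - N * (u + 1 : ℕ) + N = m + N - N * (u + 1 : ℕ) := by ring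
    rw [hi, ← add_smul]
    congr 1
    -- Here `σ = i / N - 1`, where `i = m + N - N (u + 1)` is the index of the coefficient of `q`
    -- involved.
    have h := powCoeff_succ_sub u ((m : ℂ) / N - (u + 1 : ℕ))
    have h1 : (m : ℂ) / N - (u + 1 : ℕ) + 1 = m / N - u := by push_cast; ring
    have h2 : ((m + N : ℤ) : ℂ) / N - (u + 1 : ℕ) = m / N - u := by
      push_cast; field_simp; ring
    rw [h1] at h
    rw [h, h2]
    have h3 : (e : ℂ) * m = 2 * (m / N) := by
      rw [← heC]; field_simp
    push_cast
    rw [h3]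
    ring
  · simp [powCoeff_zero]

end

/-! ### Families polynomial in the exponent, and interpolation. -/

/-- A family of series whose `i`-th member has order bounded below by `i` plus a constant, and
whose coefficients of index `i + M`, multiplied by `t ^ i`, are polynomial in `i`. -/
structure PolyFam (t : Rˣ) (q : ℤ → SkewLaurent N δ) : Prop where
  exists_valGE : ∃ a, ∀ i, (q i).ValGE (i + a)
  isPoly : ∀ M, IsPoly fun i => (q i).coeff (i + M) * ((t ^ i : Rˣ) : R)

theorem coeff_transform_single_one_eq_zero (T : ChangeOfVariable D) (e : ℤ) {m : ℤ}
    (hm : ∀ u : ℕ, m ≠ N * u + 1) :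
    (transform T e (single 1 1 : SkewLaurent N δ)).coeff m = 0 := by
  refine finsum_eq_zero_of_forall_eq_zero fun u => ?_
  rw [coeff_single, if_neg fun h => hm u (by linarith), map_zero, zero_mul, smul_zero]

section

variable [NeZero N]

/-- At a fixed offset `M`, the exponent `i` enters `X ^ i p` only through the polynomials `c_k(i)`,
and the number of contributing `k` does not depend on `i`. -/
theorem polyFam_single_mul (p : SkewLaurent N δ) : PolyFam 1 fun i => single i 1 * p := by
  obtain ⟨b, hb⟩ := p.exists_valGE
  refine ⟨⟨b, fun i => (valGE_single i 1).mul hb⟩, fun M => ?_⟩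
  have h : ∀ i : ℤ, (single i 1 * p : SkewLaurent N δ).coeff (i + M) * ((1 ^ i : Rˣ) : R) =
      ∑ k ∈ Finset.range ((M - b).toNat + 1), twistCoeff N ((i + 0 : ℤ) : ℂ) k •
        (δ^[k]) (p.coeff (M - N * k)) := fun i => by
    rw [coeff_single_mul i 1 hb (i + M) ((M - b).toNat + 1) (by omega), one_zpow, Units.val_one,
      mul_one]
    simp only [one_mul, add_zero, add_sub_cancel_left]
  simp only [h]
  exact IsPoly.sum _ fun k _ => (isPoly_twistCoeff N 0 k).smul (.const _)

theorem polyFam_single : PolyFam 1 fun i => (single i 1 : SkewLaurent N δ) := by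
  simpa only [mul_one] using polyFam_single_mul (1 : SkewLaurent N δ)

theorem PolyFam.mul_right {t : Rˣ} {q : ℤ → SkewLaurent N δ} (hq : PolyFam t q)
    (p : SkewLaurent N δ) : PolyFam t fun i => q i * p := by
  obtain ⟨a, ha⟩ := hq.exists_valGE
  obtain ⟨b, hb⟩ := p.exists_valGE
  refine ⟨⟨a + b, fun i => by simpa only [add_assoc] using (ha i).mul hb⟩, fun M => ?_⟩
  have h : ∀ i : ℤ, (q i * p).coeff (i + M) * ((t ^ i : Rˣ) : R) =
      ∑ l ∈ Finset.Ico a (M - b + 1), ∑ k ∈ Finset.range ((M - b - a).toNat + 1),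
        twistCoeff N ((i + l : ℤ) : ℂ) k • ((q i).coeff (i + l) * ((t ^ i : Rˣ) : R) *
          (δ^[k]) (p.coeff (M - l - N * k))) := fun i => by
    rw [coeff_mul_eq_sum (ha i) hb (i + M) (i + (M - b + 1)) ((M - b - a).toNat + 1) (by omega)
      (by omega), ← Finset.map_add_left_Ico, Finset.sum_map, Finset.sum_mul]
    refine Finset.sum_congr rfl fun l _ => ?_
    rw [Finset.sum_mul]
    refine Finset.sum_congr rfl fun k _ => ?_
    simp only [mulTerm, addLeftEmbedding_apply, add_sub_add_left_eq_sub, smul_mul_assoc]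
    rw [mul_right_comm]
  simp only [h]
  exact IsPoly.sum _ fun l _ => IsPoly.sum _ fun k _ =>
    (isPoly_twistCoeff N l k).smul ((hq.isPoly l).mul (.const _))

/-- The transform introduces `s ^ (-(e i))`, which is not polynomial in `i`. Absorbing `s ^ e` into
the normalizing unit removes it, and the remaining dependence through `P_u((i + M) / N - u)` is
polynomial. -/
theorem PolyFam.transform {t : Rˣ} {q : ℤ → SkewLaurent N δ} (hq : PolyFam t q)
    (T : ChangeOfVariable D) (e : ℤ) :
    PolyFam (Units.map (T.φ : R →* R) t * T.s ^ e) fun i => transform T e (q i) := by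
  obtain ⟨a, ha⟩ := hq.exists_valGE
  refine ⟨⟨a, fun i => (ha i).transform T e⟩, fun M => ?_⟩
  have h : ∀ i : ℤ, (SkewLaurent.transform T e (q i)).coeff (i + M) *
      (((Units.map (T.φ : R →* R) t * T.s ^ e) ^ i : Rˣ) : R) =
      ∑ u ∈ Finset.range ((M - a).toNat + 1), (powCoeff u ((i + (M : ℂ)) / N - u) * T.c ^ u) •
        (T.φ ((q i).coeff (i + (M - N * u)) * ((t ^ i : Rˣ) : R)) *
          ((T.s ^ (u - e * M) : Rˣ) : R)) := fun i => by
    rw [coeff_transform T e (ha i) (i + M) ((M - a).toNat + 1) (by omega), Finset.sum_mul]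
    refine Finset.sum_congr rfl fun u _ => ?_
    have e1 : ((T.s ^ (u - e * M) : Rˣ) : R) =
        ((T.s ^ (u - e * (i + M)) : Rˣ) : R) * (((T.s ^ e) ^ i : Rˣ) : R) := by
      rw [← Units.val_mul, ← zpow_mul, ← zpow_add]; congr 2; ring
    have e2 : (((Units.map (T.φ : R →* R) t) ^ i : Rˣ) : R) = T.φ ((t ^ i : Rˣ) : R) := by
      rw [← map_zpow]; rfl
    rw [mul_zpow, Units.val_mul, e1, e2, map_mul, smul_mul_assoc, add_sub_assoc]
    push_cast
    congr 1
    ring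
  simp only [h]
  refine IsPoly.sum _ fun u _ => ((isPoly_powCoeff u M N).mul (.const _)).smul (IsPoly.mul ?_
    (.const _))
  exact (hq.isPoly (M - N * u)).map (T.φ : R →+* R)

/-- Two polynomial families which agree at the indices `-(N n)` agree. -/
theorem PolyFam.ext [IsDomain R] {t : Rˣ} {q q' : ℤ → SkewLaurent N δ} (hq : PolyFam t q)
    (hq' : PolyFam t q') (h : ∀ n : ℕ, q (-(N * n)) = q' (-(N * n))) (i : ℤ) : q i = q' i := by
  have : CharZero R := charZero_of_injective_algebraMap (algebraMap ℂ R).injective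
  have hN : (N : ℤ) ≠ 0 := by exact_mod_cast NeZero.ne N
  ext m
  -- The offset `m - i` is frozen while the index of the family runs over the multiples `-(N n)`.
  have key := (hq.isPoly (m - i)).eq_of_infinite (hq'.isPoly (m - i))
    (S := Set.range fun n : ℕ => -((N : ℤ) * n))
    (Set.infinite_range_of_injective fun n n' hn => by simpa [NeZero.ne N] using hn)
    (by rintro _ ⟨n, rfl⟩; simp only [h]) i
  rw [add_sub_cancel] at key
  exact (t ^ i).isUnit.mul_right_cancel key

/-- Additive maps which preserve lower bounds on the order and agree on monomials are equal. -/
theorem addMonoidHom_ext {N' : ℕ} {R' : Type*} [CommRing R'] [Algebra ℂ R']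
    {δ' : Derivation ℂ R' R'} {F G : SkewLaurent N δ →+ SkewLaurent N' δ'} (b : ℤ)
    (hF : ∀ a q, q.ValGE a → (F q).ValGE (a + b)) (hG : ∀ a q, q.ValGE a → (G q).ValGE (a + b))
    (h : ∀ i f, F (single i f) = G (single i f)) : F = G := by
  ext q m
  obtain ⟨a, ha⟩ := q.exists_valGE
  -- The remainder has order at least `m - b + 1`, so its images under both maps have order above
  -- `m`.
  obtain ⟨s, -, hs⟩ := exists_finite_approx ha (m - b + 1)
  have e : F (∑ i ∈ s, single i (q.coeff i)) = G (∑ i ∈ s, single i (q.coeff i)) := by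
    simp only [map_sum, h]
  have h1 := hF _ _ hs m (by omega)
  have h2 := hG _ _ hs m (by omega)
  rw [map_sub, coeff_sub, sub_eq_zero] at h1 h2
  rw [h1, h2, e]

variable (T : ChangeOfVariable D) (e : ℤ)

/-! ### Multiplicativity and composition of transforms. -/

theorem transform_one : transform T e (1 : SkewLaurent N δ) = 1 := by
  rw [one_def, transform_single_zero, map_one]

theorem single_zero_mul_single (i : ℤ) (f : R) :
    (single 0 f * single i 1 : SkewLaurent N δ) = single i f := by
  rw [single_mul_single_one, zero_add]

theorem transform_mul [IsDomain R] (hδ : (N : ℂ) • δ = -D) (he : e * N = 2)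
    (q p : SkewLaurent N δ) : transform T e (q * p) = transform T e q * transform T e p := by
  have h1 : ∀ (n : ℕ) (p : SkewLaurent N δ), transform T e (single (-(N * n)) 1 * p) =
      transform T e (single (-(N * n)) 1) * transform T e p := fun n => by
    induction n with
    | zero =>
      intro p
      simp only [Nat.cast_zero, mul_zero, neg_zero, ← one_def, one_mul, transform_one]
    | succ n ih =>
      intro p
      have : (single (-(N * (n + 1 : ℕ))) 1 : SkewLaurent N δ) =
          single (-N) 1 * single (-(N * n)) 1 := by
        rw [single_mul_single_one]; congr 1; push_cast; ring
      rw [this, mul_assoc, transform_single_neg_mul T e hδ he, ih,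
        transform_single_neg_mul T e hδ he, mul_assoc]
  -- Both sides are polynomial families in `i` with the same normalizing unit, so the identity for
  -- the exponents `-(N n)` extends to all integers.
  have h2 : ∀ (i : ℤ) (p : SkewLaurent N δ), transform T e (single i 1 * p) =
      transform T e (single i 1) * transform T e p := fun i p =>
    ((polyFam_single_mul p).transform T e).ext ((polyFam_single.transform T e).mul_right _)
      (fun n => h1 n p) i
  have h3 : ∀ (i : ℤ) (f : R), transform T e (single i f * p) =
      transform T e (single i f) * transform T e p := fun i f => by
    rw [← single_zero_mul_single, mul_assoc, transform_single_zero_mul, h2,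
      transform_single_zero_mul, mul_assoc]
  obtain ⟨b, hb⟩ := p.exists_valGE
  let τ : SkewLaurent N δ →+ SkewLaurent N δ := AddMonoidHom.mk' (transform T e) (transform_add T e)
  have := addMonoidHom_ext (F := τ.comp (AddMonoidHom.mulRight p))
    (G := (AddMonoidHom.mulRight (τ p)).comp τ) b (fun a q hq => (hq.mul hb).transform T e)
    (fun a q hq => (hq.transform T e).mul (hb.transform T e)) h3
  exact DFunLike.congr_fun this q

/-- The transform as a ring endomorphism. -/
noncomputable def transformHom [IsDomain R] (hδ : (N : ℂ) • δ = -D) (he : e * N = 2) :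
    SkewLaurent N δ →+* SkewLaurent N δ :=
  RingHom.mk' ⟨⟨transform T e, transform_one T e⟩, transform_mul T e hδ he⟩ (transform_add T e)

theorem transform_single_neg_natCast [IsDomain R] (hδ : (N : ℂ) • δ = -D) (he : e * N = 2)
    (n : ℕ) : transform T e (single (-(N * n)) 1 : SkewLaurent N δ) =
      single (-N) ((T.s : R) ^ 2) ^ n := by
  induction n with
  | zero => simp [← one_def, transform_one]
  | succ n ih =>
    have : (single (-(N * (n + 1 : ℕ))) 1 : SkewLaurent N δ) =
        single (-(N * n)) 1 * single (-N) 1 := by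
      rw [single_mul_single_one]; congr 1; push_cast; ring
    rw [this, transform_mul T e hδ he, ih, transform_single_neg T e he, pow_succ _ n]

/-- Both sides send `X ^ (-N)` to `(φ₂(s₁) s₂) ^ 2 X ^ (-N)` and are multiplicative, hence agree on
its powers. Interpolation gives the other exponents. -/
theorem transform_transform [IsDomain R] (hδ : (N : ℂ) • δ = -D) (he : e * N = 2)
    (T₁ T₂ T₃ : ChangeOfVariable D) (hφ : ∀ f, T₃.φ f = T₂.φ (T₁.φ f))
    (hs : (T₃.s : R) = T₂.φ T₁.s * T₂.s) (q : SkewLaurent N δ) :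
    transform T₃ e q = transform T₂ e (transform T₁ e q) := by
  have hs' : T₃.s = Units.map (T₂.φ : R →* R) T₁.s * T₂.s := Units.ext hs
  have h1 : ∀ i : ℤ, transform T₃ e (single i 1 : SkewLaurent N δ) =
      transform T₂ e (transform T₁ e (single i 1)) := by
    have f1 := polyFam_single (N := N) (δ := δ) |>.transform T₃ e
    have f2 := (polyFam_single (N := N) (δ := δ) |>.transform T₁ e).transform T₂ e
    rw [map_one, one_mul] at f1 f2
    -- The cocycle relation makes the normalizing units of the two families equal, as `PolyFam.ext`
    -- requires.
    rw [hs', mul_zpow, ← map_zpow] at f1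
    refine f1.ext f2 fun n => ?_
    simp only [transform_single_neg_natCast _ e hδ he]
    have := map_pow (transformHom T₂ e hδ he) (single (-N) ((T₁.s : R) ^ 2)) n
    refine Eq.trans ?_ this.symm
    congr 1
    change _ = transform T₂ e _
    rw [← single_zero_mul_single (f := (T₁.s : R) ^ 2), transform_single_zero_mul,
      transform_single_neg T₂ e he, hs, mul_pow, map_pow]
    ext m
    simp only [coeff_single_zero_mul, coeff_single]
    split_ifs <;> simp
  let τ (T : ChangeOfVariable D) : SkewLaurent N δ →+ SkewLaurent N δ :=
    AddMonoidHom.mk' (transform T e) (transform_add T e)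
  have := addMonoidHom_ext (F := τ T₃) (G := (τ T₂).comp (τ T₁)) 0
    (fun a q hq => by rw [add_zero]; exact hq.transform T₃ e)
    (fun a q hq => by rw [add_zero]; exact (hq.transform T₁ e).transform T₂ e) (fun i f => by
      change transform T₃ e _ = transform T₂ e (transform T₁ e _)
      rw [← single_zero_mul_single, transform_single_zero_mul, transform_single_zero_mul,
        transform_single_zero_mul, h1, hφ])
  exact DFunLike.congr_fun this q

theorem transform_of_id (hφ : ∀ f, T.φ f = f) (hs : T.s = 1) (hc : T.c = 0)
    (q : SkewLaurent N δ) : transform T e q = q := by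
  ext m
  obtain ⟨a, ha⟩ := q.exists_valGE
  rw [coeff_transform T e ha m ((m - a).toNat + 1) (by omega), Finset.sum_eq_single 0]
  · simp [powCoeff_zero, hφ, hs]
  · intro u _ hu
    rw [hc, zero_pow hu, mul_zero, zero_smul]
  · simp

/-! ### The image of the generator, and uniqueness of square roots. -/

theorem coeff_transform_single_one (u : ℕ) :
    (transform T e (single 1 1 : SkewLaurent N δ)).coeff (N * u + 1) =
      (powCoeff u (1 / N) * T.c ^ u) • ((T.s ^ (u - e * (N * u + 1)) : Rˣ) : R) := by
  have hN : (N : ℂ) ≠ 0 := by exact_mod_cast NeZero.ne N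
  have hN1 : (1 : ℤ) ≤ N := by exact_mod_cast Nat.one_le_iff_ne_zero.2 (NeZero.ne N)
  have h2 : (u : ℤ) ≤ N * u := le_mul_of_one_le_left (by positivity) hN1
  have h0 : (N : ℤ) ≠ 0 := by omega
  rw [coeff_transform T e (valGE_single 1 1) _ (N * u + 1) (by push_cast; omega),
    Finset.sum_eq_single u]
  · rw [coeff_single, if_pos (by ring), map_one, one_mul]
    congr 3
    push_cast
    field_simp
    ring
  · intro v _ hv
    rw [coeff_single, if_neg, map_zero, zero_mul, smul_zero]
    intro h
    apply hv
    have : (N : ℤ) * v = N * u := by linarith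
    exact_mod_cast mul_left_cancel₀ h0 this
  · intro h
    rw [Finset.mem_range, not_lt] at h
    zify at h
    omega

/-- The coefficient of lowest order of a product. -/
theorem coeff_mul_lowest {q p : SkewLaurent N δ} {a b : ℤ} (hq : q.ValGE a) (hp : p.ValGE b) :
    (q * p).coeff (a + b) = q.coeff a * p.coeff b := by
  rw [coeff_mul_eq_sum hq hp (a + b) (a + 1) 1 (by omega) (by simp), Finset.sum_eq_single a]
  · simp [mulTerm, twistCoeff]
  · intro i hi hia
    rw [Finset.mem_Ico] at hi
    omega
  · simp

/-- A square root whose leading coefficient is a unit is determined by this coefficient. -/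
theorem eq_of_sq_eq_sq {q p : SkewLaurent N δ} {a : ℤ} (hq : q.ValGE a) (hp : p.ValGE a)
    (hu : IsUnit (q.coeff a)) (hc : p.coeff a = q.coeff a) (h : q ^ 2 = p ^ 2) : p = q := by
  have key : ∀ n : ℕ, (p - q).ValGE (a + n) := fun n => by
    induction n with
    | zero => intro i hi; rw [coeff_sub, hp i (by simpa using hi), hq i (by simpa using hi), sub_zero]
    | succ n ih =>
      intro i hi
      obtain hi | rfl : i < a + n ∨ i = a + n := by push_cast at hi; omega
      · exact ih i hi
      -- Since `p` and `q` need not commute, `p² - q²` is split as `p (p - q) + (p - q) q`. Its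
      -- lowest coefficient is twice the unit `q_a` times that of `p - q`, and `2` is invertible.
      · have h0 : p * (p - q) + (p - q) * q = 0 := by
          rw [mul_sub, sub_mul, ← sq, ← sq, h]; abel
        have h1 := congrArg (fun r => r.coeff (a + (a + n))) h0
        simp only [coeff_add, coeff_zero] at h1
        rw [coeff_mul_lowest hp ih, add_comm a (a + n), coeff_mul_lowest ih hq, hc,
          mul_comm _ (q.coeff a), ← two_mul] at h1
        have h2 : (2 : ℂ) • (p - q).coeff (a + n) = 0 := by
          refine hu.mul_left_cancel ?_
          rw [Algebra.smul_def, map_ofNat, mul_zero, mul_left_comm, h1]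
        simpa using congrArg ((2 : ℂ)⁻¹ • ·) h2
  ext i
  have := key (i - a + 1).toNat i (by omega)
  rwa [coeff_sub, sub_eq_zero] at this

end

end SkewLaurent

/-! ### The homographic action on functions. -/

namespace HomographicAlgebra

open SkewLaurent

variable {Γ : Subgroup (Matrix.SpecialLinearGroup (Fin 2) ℂ)} (A : HomographicAlgebra Γ)

theorem induction_on {p : A.R → Prop} (f : A.R)
    (h : ∀ (f : ℂ → ℂ) (hf : (f : Germ A.l ℂ) ∈ A.R), p ⟨f, hf⟩) : p f := by
  obtain ⟨f, hf⟩ := f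
  induction f using Germ.inductionOn with
  | _ f => exact h f hf

/-- The homographic action as an algebra endomorphism. -/
noncomputable def actHom (γ : Γ) : A.R →ₐ[ℂ] A.R where
  toFun := A.act γ
  map_one' := rfl
  map_mul' f g := by
    induction f using A.induction_on with | _ f hf
    induction g using A.induction_on with | _ g hg
    rfl
  map_zero' := rfl
  map_add' f g := by
    induction f using A.induction_on with | _ f hf
    induction g using A.induction_on with | _ g hg
    rfl
  commutes' r := rfl

/-- An inverse in `R` forces `c z + d` to be nonzero on a member of the filter, so values at the
pole of the homography never matter. -/
theorem eventually_denom_ne_zero (γ : Γ) : ∀ᶠ z in A.l, denomFun γ z ≠ 0 := by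
  have h : ((A.s γ : A.R) * (((A.s γ)⁻¹ : A.Rˣ) : A.R)) = 1 := Units.mul_inv _
  generalize (((A.s γ)⁻¹ : A.Rˣ) : A.R) = g at h
  induction g using A.induction_on with | _ g hg
  have h' : ((denomFun γ * g : ℂ → ℂ) : Germ A.l ℂ) = ((1 : ℂ → ℂ) : Germ A.l ℂ) :=
    congrArg Subtype.val h
  filter_upwards [Germ.coe_eq.1 h'] with z hz h0
  rw [Pi.mul_apply, h0, zero_mul] at hz
  exact zero_ne_one hz

/-- Numerator and denominator are both multiplied by the inner denominator, so only that one has to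
be nonzero; the outer may vanish, with division by zero giving `0` on both sides. -/
theorem moebius_mul (γ γ' : Matrix.SpecialLinearGroup (Fin 2) ℂ) {z : ℂ}
    (hz : denomFun γ' z ≠ 0) : moebius (γ * γ') z = moebius γ (moebius γ' z) := by
  simp only [denomFun] at hz
  simp only [moebius, Matrix.SpecialLinearGroup.coe_mul, Matrix.mul_apply, Fin.sum_univ_two]
  rw [← mul_div_mul_right _ _ hz]
  field_simp
  congr 1 <;> ring

theorem denomFun_mul (γ γ' : Matrix.SpecialLinearGroup (Fin 2) ℂ) {z : ℂ}
    (hz : denomFun γ' z ≠ 0) :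
    denomFun (γ * γ') z = denomFun γ (moebius γ' z) * denomFun γ' z := by
  simp only [denomFun] at hz
  simp only [denomFun, moebius, Matrix.SpecialLinearGroup.coe_mul, Matrix.mul_apply,
    Fin.sum_univ_two]
  field_simp
  ring

theorem hasDerivAt_moebius (γ : Matrix.SpecialLinearGroup (Fin 2) ℂ) {z : ℂ}
    (hz : denomFun γ z ≠ 0) : HasDerivAt (moebius γ) ((denomFun γ z ^ 2)⁻¹) z := by
  have hd : γ 0 0 * γ 1 1 - γ 0 1 * γ 1 0 = 1 := by
    rw [← Matrix.det_fin_two, γ.det_coe]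
  have h1 : HasDerivAt (fun z => γ 0 0 * z + γ 0 1) (γ 0 0) z := by
    simpa using ((hasDerivAt_id z).const_mul (γ 0 0)).add_const (γ 0 1)
  have h2 : HasDerivAt (fun z => γ 1 0 * z + γ 1 1) (γ 1 0) z := by
    simpa using ((hasDerivAt_id z).const_mul (γ 1 0)).add_const (γ 1 1)
  have h := h1.div h2 hz
  have e : (γ 0 0 * (γ 1 0 * z + γ 1 1) - (γ 0 0 * z + γ 0 1) * γ 1 0) / (γ 1 0 * z + γ 1 1) ^ 2 =
      (denomFun γ z ^ 2)⁻¹ := by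
    rw [inv_eq_one_div]
    congr 1
    linear_combination hd
  rw [e] at h
  exact h

theorem act_mul (γ γ' : Γ) (f : A.R) : A.act (γ * γ') f = A.act γ' (A.act γ f) := by
  induction f using A.induction_on with | _ f hf
  refine Subtype.ext (Germ.coe_eq.2 ?_)
  filter_upwards [A.eventually_denom_ne_zero γ'] with z hz
  exact congrArg f (moebius_mul γ γ' hz)

/-- The cocycle relation, which makes the transforms compose as a right action. -/
theorem s_mul (γ γ' : Γ) : (A.s (γ * γ') : A.R) = A.act γ' (A.s γ) * A.s γ' := by
  refine Subtype.ext (Germ.coe_eq.2 ?_)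
  filter_upwards [A.eventually_denom_ne_zero γ'] with z hz
  exact denomFun_mul γ γ' hz

theorem act_one (f : A.R) : A.act 1 f = f := by
  induction f using A.induction_on with | _ f hf
  refine Subtype.ext (Germ.coe_eq.2 (Eventually.of_forall fun z => congrArg f ?_))
  simp [moebius]

theorem s_one : A.s 1 = 1 := by
  refine Units.ext (Subtype.ext (Germ.coe_eq.2 (Eventually.of_forall fun z => ?_)))
  simp [denomFun]

theorem dz_s (γ : Γ) : A.dz (A.s γ : A.R) =
    algebraMap ℂ A.R ((γ : Matrix.SpecialLinearGroup (Fin 2) ℂ) 1 0) := by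
  rw [Algebra.algebraMap_eq_smul_one]
  refine Subtype.ext (Germ.coe_eq.2 (Eventually.of_forall fun z => ?_))
  have : HasDerivAt (denomFun γ) ((γ : Matrix.SpecialLinearGroup (Fin 2) ℂ) 1 0) z := by
    have h := ((hasDerivAt_id z).const_mul
      ((γ : Matrix.SpecialLinearGroup (Fin 2) ℂ) 1 0)).add_const
      ((γ : Matrix.SpecialLinearGroup (Fin 2) ℂ) 1 1)
    rw [mul_one] at h
    exact h
  rw [this.deriv]
  simp

/-- The chain rule, with `(c z + d)⁻²` the derivative of the homography by `det γ = 1`.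
Differentiability of `f` at the image point comes from pulling back along `tendsto_moebius`. -/
theorem sq_s_mul_dz_act (γ : Γ) (f : A.R) :
    (A.s γ : A.R) ^ 2 * A.dz (A.act γ f) = A.act γ (A.dz f) := by
  induction f using A.induction_on with | _ f hf
  refine Subtype.ext (Germ.coe_eq.2 ?_)
  filter_upwards [A.eventually_denom_ne_zero γ,
    (A.tendsto_moebius γ γ.2).eventually (A.differentiable f hf)] with z hz hd
  have h := hd.hasDerivAt.comp z (hasDerivAt_moebius γ hz)
  change denomFun γ z ^ 2 * deriv (f ∘ moebius γ) z = deriv f (moebius γ z)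
  rw [h.deriv]
  field_simp

/-! ### The resulting automorphisms of the series rings. -/

/-- The change of variable given by an element of `Γ`. -/
noncomputable def changeOfVariable (γ : Γ) : ChangeOfVariable A.dz where
  φ := A.actHom γ
  s := A.s γ
  c := (γ : Matrix.SpecialLinearGroup (Fin 2) ℂ) 1 0
  map_s := A.dz_s γ
  comm := A.sq_s_mul_dz_act γ

section

variable {N : ℕ} [NeZero N] {δ : Derivation ℂ A.R A.R} {e : ℤ}

theorem transform_changeOfVariable_mul (hδ : (N : ℂ) • δ = -A.dz) (he : e * N = 2) (γ γ' : Γ)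
    (q : SkewLaurent N δ) : transform (A.changeOfVariable (γ * γ')) e q =
      transform (A.changeOfVariable γ') e (transform (A.changeOfVariable γ) e q) :=
  have := A.isDomain
  transform_transform e hδ he _ _ _ (A.act_mul γ γ') (A.s_mul γ γ') q

theorem transform_changeOfVariable_one (q : SkewLaurent N δ) :
    transform (A.changeOfVariable 1) e q = q :=
  transform_of_id _ e A.act_one A.s_one (by simp [changeOfVariable]) q

/-- The automorphism of the ring of skew Laurent series given by an element of `Γ`. -/
noncomputable def autEquiv (hδ : (N : ℂ) • δ = -A.dz) (he : e * N = 2) (γ : Γ) :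
    SkewLaurent N δ ≃+* SkewLaurent N δ where
  toFun := transform (A.changeOfVariable γ) e
  invFun := transform (A.changeOfVariable γ⁻¹) e
  left_inv q := by
    rw [← A.transform_changeOfVariable_mul hδ he, mul_inv_cancel, transform_changeOfVariable_one]
  right_inv q := by
    rw [← A.transform_changeOfVariable_mul hδ he, inv_mul_cancel, transform_changeOfVariable_one]
  map_mul' := have := A.isDomain; transform_mul _ e hδ he
  map_add' := transform_add _ e

/-- The image of `X ^ N` is a left inverse of `s ^ 2 X ^ (-N)`, for which `X ^ N s⁻²`, with the
coefficient on the right, is a right inverse. -/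
theorem autEquiv_single_natCast (hδ : (N : ℂ) • δ = -A.dz) (he : e * N = 2) (γ : Γ) :
    A.autEquiv hδ he γ (single N 1) =
      single N 1 * single 0 (((A.s γ)⁻¹ : A.Rˣ) : A.R) ^ 2 := by
  have h1 : (A.autEquiv hδ he γ (single N 1)) * A.autEquiv hδ he γ (single (-N) 1) = 1 := by
    rw [← map_mul, single_mul_single_one, add_neg_cancel, ← one_def, map_one]
  have h2 : A.autEquiv hδ he γ (single (-N) 1) = single (-N) ((A.s γ : A.R) ^ 2) :=
    transform_single_neg _ e he
  have h3 : (single 0 ((A.s γ : A.R)) * single 0 (((A.s γ)⁻¹ : A.Rˣ) : A.R) :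
      SkewLaurent N δ) = 1 := by
    refine SkewLaurent.ext (funext fun m => ?_)
    rw [coeff_single_zero_mul, one_def]
    simp only [coeff_single]
    split_ifs <;> simp
  have h4 : (single (-N) ((A.s γ : A.R) ^ 2) : SkewLaurent N δ) =
      single 0 ((A.s γ : A.R)) ^ 2 * single (-N) 1 := by
    refine SkewLaurent.ext (funext fun m => ?_)
    rw [sq (single 0 _), mul_assoc, coeff_single_zero_mul, coeff_single_zero_mul]
    simp only [coeff_single]
    split_ifs <;> simp [sq]
  rw [h2] at h1
  have h5 : (single (-N) ((A.s γ : A.R) ^ 2) : SkewLaurent N δ) *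
      (single N 1 * single 0 (((A.s γ)⁻¹ : A.Rˣ) : A.R) ^ 2) = 1 := by
    have h6 : (single (-N) 1 * single N 1 : SkewLaurent N δ) = 1 := by
      rw [single_mul_single_one, neg_add_cancel, one_def]
    rw [h4, mul_assoc, ← mul_assoc (single (-N : ℤ) 1), h6, one_mul, sq, sq, mul_assoc,
      ← mul_assoc (single 0 (A.s γ : A.R)) (single 0 _) (single 0 _), h3, one_mul, h3]
  exact left_inv_eq_right_inv h1 h5

end

/-! ### The actions on `B` and `C`, and their compatibility. -/

theorem one_smul_neg_dz : ((1 : ℕ) : ℂ) • (-A.dz) = -A.dz := by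
  rw [Nat.cast_one, one_smul]

theorem two_smul_half_neg_dz : ((2 : ℕ) : ℂ) • ((1 / 2 : ℂ) • (-A.dz)) = -A.dz := by
  rw [smul_smul]
  norm_num

/-- The action on `B`. -/
noncomputable def actB (γ : Γ) : A.B ≃+* A.B :=
  A.autEquiv (e := 2) A.one_smul_neg_dz (by norm_num) γ

/-- The action on `C`. -/
noncomputable def actC (γ : Γ) : A.C ≃+* A.C :=
  A.autEquiv (e := 1) A.two_smul_half_neg_dz (by norm_num) γ

theorem isExtensionB_actB : A.IsExtensionB A.actB where
  mul_act := A.transform_changeOfVariable_mul A.one_smul_neg_dz (by norm_num)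
  act_const γ f := transform_single_zero _ _ f
  act_x_inv γ := transform_single_neg (N := 1) _ _ (by norm_num)

theorem actC_single_one_coeff_one (γ : Γ) :
    (A.actC γ (single 1 1)).coeff 1 = (((A.s γ)⁻¹ : A.Rˣ) : A.R) := by
  have := coeff_transform_single_one (δ := (1 / 2 : ℂ) • (-A.dz)) (N := 2) (A.changeOfVariable γ) 1 0
  rw [powCoeff_zero, pow_zero, mul_one, one_smul] at this
  simp only [Nat.cast_zero, mul_zero, zero_add, mul_one, zero_sub, zpow_neg_one] at this
  exact this

theorem actC_single_one_valGE (γ : Γ) : (A.actC γ (single 1 1)).ValGE 1 :=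
  (valGE_single 1 1).transform _ _

theorem actC_single_one_sq (γ : Γ) : A.actC γ (single 1 1) ^ 2 =
    single 2 1 * single 0 (((A.s γ)⁻¹ : A.Rˣ) : A.R) ^ 2 := by
  rw [← map_pow, sq, single_mul_single_one]
  exact A.autEquiv_single_natCast A.two_smul_half_neg_dz (by norm_num) γ

theorem isExtensionC_actC : A.IsExtensionC A.actC where
  mul_act := A.transform_changeOfVariable_mul A.two_smul_half_neg_dz (by norm_num)
  act_const γ f := transform_single_zero _ _ f
  act_y_sq := A.actC_single_one_sq
  act_y_valuation := A.actC_single_one_valGE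
  act_y_leading := A.actC_single_one_coeff_one

theorem ValGE.inclusion {q : A.B} {a : ℤ} (hq : q.ValGE a) : (A.inclusion q).ValGE (2 * a) :=
  fun i hi => by
    change (if Even i then q.coeff (i / 2) else 0) = 0
    split_ifs
    · exact hq _ (by omega)
    · rfl

/-- The coefficient formula involves the index `m` only through `m / N`, `e m` and `m - N u`. Index
`2 k` with `(N, e) = (2, 1)` therefore gives the same sum as index `k` with `(1, 2)`. -/
theorem actC_inclusion (γ : Γ) (q : A.B) :
    A.actC γ (A.inclusion q) = A.inclusion (A.actB γ q) := by
  refine SkewLaurent.ext (funext fun m => ?_)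
  obtain ⟨a, ha⟩ := q.exists_valGE
  set K : ℕ := (m - 2 * a).toNat + (m / 2 - a).toNat + 1
  have h1 := coeff_transform (A.changeOfVariable γ) 1 (ValGE.inclusion A ha) m K (by omega)
  have h2 := coeff_transform (A.changeOfVariable γ) 2 ha (m / 2) K (by omega)
  refine h1.trans ?_
  change _ = if Even m then (transform (A.changeOfVariable γ) 2 q).coeff (m / 2) else 0
  rw [h2]
  split_ifs with hm
  · obtain ⟨k, rfl⟩ := hm
    refine Finset.sum_congr rfl fun u _ => ?_
    have e0 : (k + k) / 2 = k := by omega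
    have e1 : (A.inclusion q).coeff (k + k - (2 : ℕ) * u) = q.coeff (k - (1 : ℕ) * u) := by
      change (if Even _ then q.coeff _ else 0) = _
      rw [if_pos ⟨k - u, by push_cast; ring⟩]
      congr 1
      push_cast
      omega
    rw [e0, e1]
    congr 3
    · push_cast; ring
    · congr 2; ring
  · refine Finset.sum_eq_zero fun u _ => ?_
    have e1 : (A.inclusion q).coeff (m - (2 : ℕ) * u) = 0 := by
      change (if Even _ then q.coeff _ else 0) = _
      rw [if_neg]
      intro h
      apply hm
      rw [Int.even_iff] at h ⊢
      push_cast at h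
      omega
    rw [e1, map_zero, zero_mul, smul_zero]

/-! ### Uniqueness on generators and closed forms of the coefficients. -/

theorem IsExtensionB.apply_single_one {ρ : Γ → (A.B ≃+* A.B)} (h : A.IsExtensionB ρ) (γ : Γ) :
    ρ γ (single 1 1) = A.actB γ (single 1 1) := by
  have h1 : (single 1 1 * single (-1) 1 : A.B) = 1 := by
    rw [single_mul_single_one, add_neg_cancel, one_def]
  have h2 : (single (-1) 1 * single 1 1 : A.B) = 1 := by
    rw [single_mul_single_one, neg_add_cancel, one_def]
  have e1 : ρ γ (single 1 1) * ρ γ (single (-1) 1) = 1 := by rw [← map_mul, h1, map_one]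
  have e2 : A.actB γ (single (-1) 1) * A.actB γ (single 1 1) = 1 := by
    rw [← map_mul, h2, map_one]
  rw [A.isExtensionB_actB.act_x_inv, ← h.act_x_inv] at e2
  exact left_inv_eq_right_inv e1 e2

theorem IsExtensionC.apply_single_one {ρ : Γ → (A.C ≃+* A.C)} (h : A.IsExtensionC ρ) (γ : Γ) :
    ρ γ (single 1 1) = A.actC γ (single 1 1) := by
  refine eq_of_sq_eq_sq (A.actC_single_one_valGE γ) (h.act_y_valuation γ) ?_ ?_ ?_
  · rw [actC_single_one_coeff_one]
    exact Units.isUnit _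
  · rw [actC_single_one_coeff_one, h.act_y_leading]
  · rw [actC_single_one_sq, h.act_y_sq]

theorem ratio_pow (γ : Γ) (n : ℕ) : A.ratio γ ^ n =
    ((γ : Matrix.SpecialLinearGroup (Fin 2) ℂ) 1 0) ^ n •
      (((A.s γ) ^ (-(n : ℤ)) : A.Rˣ) : A.R) := by
  rw [ratio, smul_pow, zpow_neg, zpow_natCast, ← inv_pow, Units.val_pow_eq_pow_val]

/-- `(1)_n (2)_n / n! = (2)_n = (n + 1)!`. -/
theorem powCoeff_one (n : ℕ) : powCoeff n 1 = (n + 1).factorial := by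
  induction n with
  | zero => simp [powCoeff_zero]
  | succ n ih =>
    have h0 : (n : ℂ) + 1 ≠ 0 := Nat.cast_add_one_ne_zero n
    rw [powCoeff, Finset.prod_range_succ, ← powCoeff, ih, Nat.factorial_succ (n + 1)]
    push_cast
    field_simp
    ring

/-- Here `(1/2)_u = (2u)! / (4 ^ u u!)` and `(3/2)_u = (2u + 1)! / (4 ^ u u!)`. -/
theorem powCoeff_half (u : ℕ) : powCoeff u (1 / 2) =
    ((2 * u + 1).factorial * (2 * u).factorial : ℂ) / (16 ^ u * (u.factorial : ℂ) ^ 3) := by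
  induction u with
  | zero => simp [powCoeff_zero]
  | succ u ih =>
    have h0 : (u : ℂ) + 1 ≠ 0 := Nat.cast_add_one_ne_zero u
    have h1 : (u.factorial : ℂ) ≠ 0 := by exact_mod_cast u.factorial_ne_zero
    rw [powCoeff, Finset.prod_range_succ, ← powCoeff, ih, show 2 * (u + 1) = 2 * u + 1 + 1 by ring,
      Nat.factorial_succ (2 * u + 1 + 1), Nat.factorial_succ (2 * u + 1), Nat.factorial_succ u,
      Nat.factorial_succ (2 * u)]
    push_cast
    field_simp
    ring

end HomographicAlgebra

/-- The homographic action of `Γ` extends to `B` and `C` (with `r = 0`), compatibly with the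
inclusion of `B` in `C`, and these extensions are given on the generators by
`x · γ = ∑ₙ (n + 1)! (c z + d)⁻² (c / (c z + d)) ^ n x ^ (n + 1)` and
`y · γ = ∑ᵤ (2u + 1)! (2u)! / (16 ^ u (u!) ^ 3) (c z + d)⁻¹ (c / (c z + d)) ^ u y ^ (2 u + 1)`. -/
theorem mainTheorem7 (Γ : Subgroup (Matrix.SpecialLinearGroup (Fin 2) ℂ))
    (A : HomographicAlgebra Γ) :
    (∃ (ρB : Γ → (A.B ≃+* A.B)) (ρC : Γ → (A.C ≃+* A.C)),
      A.IsExtensionB ρB ∧ A.IsExtensionC ρC ∧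
        ∀ γ q, ρC γ (A.inclusion q) = A.inclusion (ρB γ q)) ∧
    (∀ ρB : Γ → (A.B ≃+* A.B), A.IsExtensionB ρB → ∀ γ : Γ,
      (∀ n : ℕ, (ρB γ (SkewLaurent.single 1 1)).coeff (n + 1) =
        ((n + 1).factorial : ℂ) • ((((A.s γ)⁻¹ : A.Rˣ) : A.R) ^ 2 * A.ratio γ ^ n)) ∧
      ∀ m : ℤ, (∀ n : ℕ, m ≠ n + 1) → (ρB γ (SkewLaurent.single 1 1)).coeff m = 0) ∧
    (∀ ρC : Γ → (A.C ≃+* A.C), A.IsExtensionC ρC → ∀ γ : Γ,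
      (∀ u : ℕ, (ρC γ (SkewLaurent.single 1 1)).coeff (2 * u + 1) =
        (((2 * u + 1).factorial * (2 * u).factorial : ℂ) / (16 ^ u * (u.factorial : ℂ) ^ 3)) •
          ((((A.s γ)⁻¹ : A.Rˣ) : A.R) * A.ratio γ ^ u)) ∧
      ∀ m : ℤ, (∀ u : ℕ, m ≠ 2 * u + 1) → (ρC γ (SkewLaurent.single 1 1)).coeff m = 0) := by
  refine ⟨⟨A.actB, A.actC, A.isExtensionB_actB, A.isExtensionC_actC, A.actC_inclusion⟩,
    fun ρ hρ γ => ?_, fun ρ hρ γ => ?_⟩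
  · rw [hρ.apply_single_one A γ]
    refine ⟨fun n => ?_, fun m hm => ?_⟩
    · have h := SkewLaurent.coeff_transform_single_one (δ := -A.dz) (N := 1) (A.changeOfVariable γ) 2 n
      have e1 : (((1 : ℕ) : ℤ) * n + 1) = n + 1 := by push_cast; ring
      rw [e1, Nat.cast_one, div_one, HomographicAlgebra.powCoeff_one] at h
      refine h.trans ?_
      -- The exponent is `-2 - n`: two factors from `(c z + d)⁻²` and `n` from the power of `c / (c
      -- z + d)`.
      have e2 : ((((A.s γ) ^ ((n : ℤ) - 2 * (n + 1))) : A.Rˣ) : A.R) =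
          (((A.s γ)⁻¹ : A.Rˣ) : A.R) ^ 2 * (((A.s γ) ^ (-(n : ℤ)) : A.Rˣ) : A.R) := by
        rw [← Units.val_pow_eq_pow_val, ← Units.val_mul, ← zpow_neg_one, ← zpow_natCast,
          ← zpow_mul, ← zpow_add]
        congr 2
        push_cast
        ring
      rw [HomographicAlgebra.ratio_pow, mul_smul_comm, smul_smul, ← e2]
      rfl
    · exact SkewLaurent.coeff_transform_single_one_eq_zero (N := 1) _ _ fun u h => hm u (by simpa using h)
  · rw [hρ.apply_single_one A γ]
    refine ⟨fun n => ?_, fun m hm => ?_⟩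
    · have h := SkewLaurent.coeff_transform_single_one (δ := (1 / 2 : ℂ) • (-A.dz)) (N := 2)
        (A.changeOfVariable γ) 1 n
      rw [Nat.cast_ofNat, Nat.cast_ofNat, HomographicAlgebra.powCoeff_half] at h
      refine h.trans ?_
      have e2 : ((((A.s γ) ^ ((n : ℤ) - 1 * (2 * n + 1))) : A.Rˣ) : A.R) =
          (((A.s γ)⁻¹ : A.Rˣ) : A.R) * (((A.s γ) ^ (-(n : ℤ)) : A.Rˣ) : A.R) := by
        rw [← Units.val_mul, ← zpow_neg_one, ← zpow_add]
        congr 2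
        ring
      rw [HomographicAlgebra.ratio_pow, mul_smul_comm, smul_smul, ← e2]
      rfl
    · exact SkewLaurent.coeff_transform_single_one_eq_zero (N := 2) _ _ fun u h => hm u (by simpa using h)
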